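/- **Setting.** A Boolean algebra $\mathcal B$ is a relatively complemented distributive lattice with least element $\emptyset$ (a largest element is not required). Let $\mathcal L$ be a set, let $\theta_a:\mathcal B\to\mathcal B$ ($a\in\mathcal L$) be maps preserving $\cap,\cup,\setminus$ and $\emptyset$, and let $\mathcal I_a\subseteq\mathcal B$ ($a\in\mathcal L$) be ideals with $\theta_a(\mathcal B)\subseteq\mathcal I_a$; then $(\mathcal B,\mathcal L,\theta,\mathcal I_\alpha)$ is a generalized Boolean dynamical system. For a word $\alpha=\alpha_1\cdots\alpha_n$ put $\theta_\alpha=\theta_{\alpha_n}\circ\cdots\circ\theta_{\alpha_1}$ and, if $n\ge1$, $\mathcal I_\alpha=\{A: A\subseteq\theta_{\alpha_2\cdots\alpha_n}(B)\text{ for some }B\in\mathcal I_{\alpha_1}\}$; put $\mathcal I_\emptyset=\mathcal B$. Let $\mathcal W^*$ be the set of finite words $\alpha$ with $\mathcal I_\alpha\ne\{\emptyset\}$. **Condition (L).** Let $\Delta_A=\{a\in\mathcal L:\theta_a(A)\neq\emptyset\}$; $A$ is regular if $0<|\Delta_B|<\infty$ for all $\emptyset\ne B\subseteq A$. A pair $(\alpha,A)$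 of a word $\alpha=\alpha_1\cdots\alpha_n$, $n\ge1$, and $A\neq\emptyset$ is a cycle if $\theta_\alpha(B)=B$ for all $B\subseteq A$; it has no exits if for all $1\le t\le n$ and all $\emptyset\neq B\subseteq\theta_{\alpha_1\cdots\alpha_t}(A)$ the element $B$ is regular and $\Delta_B=\{\alpha_{t+1}\}$, where $\alpha_{n+1}:=\alpha_1$. Condition (L) says that there is no cycle without exits. **Boundary paths.** For an ideal $\mathcal I$ of $\mathcal B$ let $\widehat{\mathcal I}$ be the set of ultrafilters of $\mathcal I$, with the topology generated by the sets $\{\eta: A\in\eta\}$, $A\in\mathcal I$. Let $E^0=\widehat{\mathcal B}$, let $F^0=E^0\cup\{\emptyset\}$, where $\emptyset$ is the point at infinity of the one-point compactification (isolated if $\mathcal B$ has a largest element), and let $E^1=\{e^a_\eta: a\in\mathcal L,\ \eta\in\widehat{\mathcal I_a}\}=\bigsqcup_a\widehat{\mathcal I_a}$. Define $d:E^1\to E^0$ and $r:E^1\to F^0$ by $d(e^a_\eta)=\{A\in\mathcal B: A\supseteq C\text{ for some }C\in\eta\}$ and $r(e^a_\eta)=\{A\in\mathcal B:\theta_a(A)\in\eta\}$.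 A path is a vertex (an element of $E^0$) or a finite or infinite sequence of edges $e_1e_2\cdots$ with $d(e_i)=r(e_{i+1})$. For a path with at least one edge, $r$ is the range of its first edge, and if it is finite, $d$ is the $d$ of its last edge; for a vertex $\chi$, $r(\chi)=d(\chi)=\chi$. The space $E^*$ of finite paths is the disjoint union of $E^0$ and the spaces $E^n\subseteq(E^1)^n$ of paths of length $n\ge1$. Put $F^0_{sce}=F^0\setminus\overline{r(E^1)}$, $F^0_{fin}=\{v\in F^0: v\text{ has a neighbourhood }V\text{ with }r^{-1}(V)\text{ compact}\}$ and $E^0_{sg}=E^0\setminus(F^0_{fin}\setminus\overline{F^0_{sce}})$. The boundary path space $\partial E$ consists of all infinite paths and all finite paths $\mu$ with $d(\mu)\in E^0_{sg}$. Its topology is generated by the sets $\mathcal Z(U)\setminus\mathcal Z(K)$ with $U\subseteq E^*$ open and $K\subseteq E^*$ compact, where $\mathcal Z(S)$ is the set of $\mu\in\partial E$ such that $r(\mu)\in S$ or some initial segment of $\mu$ of positive length lies in $S$. **Partial action.** Let $\mathbb F$ be the free group on $\mathcal L$. Put $U_1=\partial E$. If $1\ne t=\alpha\beta^{-1}$ in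 reduced form with $\alpha,\beta\in\mathcal W^*$ and $\mathcal I_\alpha\cap\mathcal I_\beta\neq\{\emptyset\}$, let $U_t$ be the set of the $\mu\in\partial E$ whose first $|\alpha|$ edges are $e^{\alpha_1}_{\eta_1},\dots,e^{\alpha_{|\alpha|}}_{\eta_{|\alpha|}}$ for some ultrafilters $\eta_i$ with $\eta_{|\alpha|}\cap\mathcal I_\beta\neq\varnothing$ (with $r(\mu)\cap\mathcal I_\beta\ne\varnothing$ if $\alpha=\emptyset$). For all other $t$ let $U_t=\varnothing$. The map $\varphi_1$ is the identity, and for $t=\alpha\beta^{-1}$ in reduced form $\varphi_t:U_{t^{-1}}\to U_t$ removes the first $|\beta|$ edges of $\mu$, which leaves a path $\nu$ (the vertex $d(\mu)$ if $|\mu|=|\beta|>0$), and returns $e^{\alpha_1}_{\eta_1}\cdots e^{\alpha_n}_{\eta_n}\nu$, where $\eta_n=r(\nu)\cap\mathcal I_{\alpha_n}$ and $\eta_i=r(e^{\alpha_{i+1}}_{\eta_{i+1}})\cap\mathcal I_{\alpha_i}$ for $i<n$. The partial action $\Phi=(\{U_t\},\{\varphi_t\})$ is topologically free if for every $t\ne1$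 the set $\{\mu\in U_{t^{-1}}:\varphi_t(\mu)=\mu\}$ has empty interior in $\partial E$. **Groupoid.** $\mathbb F\ltimes_\varphi\partial E=\{(t,\mu):t\in\mathbb F,\ \mu\in U_t\}$, with the topology inherited from $\mathbb F\times\partial E$ ($\mathbb F$ discrete), $r(t,\mu)=\mu$, $s(t,\mu)=\varphi_{t^{-1}}(\mu)$, $(t,\mu)(s,\nu)=(ts,\mu)$ if $\varphi_{t^{-1}}(\mu)=\nu$, $(t,\mu)^{-1}=(t^{-1},\varphi_{t^{-1}}(\mu))$, and unit space $\{1\}\times\partial E$, identified with $\partial E$. A groupoid $\mathcal G$ with a topology is topologically principal if the units $u$ with $\{\gamma: r(\gamma)=s(\gamma)=u\}=\{u\}$ are dense in $\mathcal G^{(0)}$, and effective if the interior of $\{\gamma: r(\gamma)=s(\gamma)\}$ in $\mathcal G$ equals $\mathcal G^{(0)}$. **Proposition.** Let $(\mathcal B,\mathcal L,\theta,\mathcal I_\alpha)$ be a generalized Boolean dynamical system. Consider the conditions: 1. $(\mathcal B,\mathcal L,\theta)$ satisfies Condition (L); 2. $\Phi$ is topologically free; 3. $\mathbb F\ltimes_\varphi\partial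 E$ is topologically principal; 4. $\mathbb F\ltimes_\varphi\partial E$ is effective. Then (1)$\iff$(2)$\iff$(3)$\implies$(4). Moreover, if $\mathcal B$ and $\mathcal L$ are countable, then (4)$\implies$(3). -/

import Mathlib

namespace BooleanDynamics

universe u v

/-! ## Ultrafilters and Stone duals -/

section Filters

variable {B : Type u} [GeneralizedBooleanAlgebra B]

/-- `ξ` is a filter of the ideal `I`, where `I` is regarded as a Boolean algebra in its own right:
a nonempty down-directed upper subset of `I` that does not contain the least element.
For `I = Set.univ` these are the filters of `B`. -/
def IsFilterIn (I ξ : Set B) : Prop :=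
  ξ ⊆ I ∧ ξ.Nonempty ∧ ⊥ ∉ ξ ∧
    (∀ A ∈ ξ, ∀ C ∈ I, A ≤ C → C ∈ ξ) ∧
    (∀ A ∈ ξ, ∀ C ∈ ξ, ∃ D ∈ ξ, D ≤ A ∧ D ≤ C)

/-- Ultrafilters of `I`: the filters of `I` that are maximal with respect to inclusion. -/
def IsUltrafilterIn (I ξ : Set B) : Prop :=
  Maximal (IsFilterIn I) ξ

/-- The Stone dual of `I`: the set of ultrafilters of `I`. -/
@[ext]
structure Stone (I : Set B) : Type u where
  carrier : Set B
  isUltrafilterIn : IsUltrafilterIn I carrier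

/-- The topology of the Stone dual, generated by the sets `{ξ | A ∈ ξ}` for `A ∈ I`. -/
instance (I : Set B) : TopologicalSpace (Stone I) :=
  TopologicalSpace.generateFrom {s | ∃ A ∈ I, s = {ξ : Stone I | A ∈ ξ.1}}

variable {I ξ : Set B}

theorem IsUltrafilterIn.isFilterIn (h : IsUltrafilterIn I ξ) : IsFilterIn I ξ := h.1

theorem IsFilterIn.inf_mem (hI : IsLowerSet I) (h : IsFilterIn I ξ) {A C : B}
    (hA : A ∈ ξ) (hC : C ∈ ξ) : A ⊓ C ∈ ξ := by
  obtain ⟨D, hD, h1, h2⟩ := h.2.2.2.2 A hA C hC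
  exact h.2.2.2.1 D hD _ (hI inf_le_left (h.1 hA)) (le_inf h1 h2)

/-- In an ultrafilter of `I`, an element of `I` that meets every member is a member. -/
theorem IsUltrafilterIn.mem_of_meets (hI : IsLowerSet I) (h : IsUltrafilterIn I ξ) {A : B}
    (hA : A ∈ I) (hm : ∀ C ∈ ξ, A ⊓ C ≠ ⊥) : A ∈ ξ := by
  have hf := h.1
  let ζ : Set B := {D | D ∈ I ∧ ∃ C ∈ ξ, A ⊓ C ≤ D}
  have hζ : IsFilterIn I ζ := by
    refine ⟨fun D hD => hD.1, ?_, ?_, ?_, ?_⟩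
    · obtain ⟨C, hC⟩ := hf.2.1
      exact ⟨A, hA, C, hC, inf_le_left⟩
    · rintro ⟨-, C, hC, hle⟩
      exact hm C hC (le_bot_iff.1 hle)
    · rintro D ⟨-, C, hC, hle⟩ E hE hDE
      exact ⟨hE, C, hC, hle.trans hDE⟩
    · rintro D ⟨hD, C, hC, hle⟩ E ⟨hE, C', hC', hle'⟩
      refine ⟨D ⊓ E, ⟨hI inf_le_left hD, C ⊓ C', hf.inf_mem hI hC hC', ?_⟩,
        inf_le_left, inf_le_right⟩
      exact le_inf (le_trans (inf_le_inf_left _ inf_le_left) hle)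
        (le_trans (inf_le_inf_left _ inf_le_right) hle')
  have hsub : ξ ⊆ ζ := fun C hC => ⟨hf.1 hC, C, hC, inf_le_right⟩
  have hback : ζ ⊆ ξ := h.2 hζ hsub
  obtain ⟨C, hC⟩ := hf.2.1
  exact hback ⟨hA, C, hC, inf_le_left⟩

theorem IsUltrafilterIn.mem_or_mem (hI : IsLowerSet I) (h : IsUltrafilterIn I ξ) {A C : B}
    (hAC : A ⊔ C ∈ ξ) : A ∈ ξ ∨ C ∈ ξ := by
  have hf := h.1
  by_contra hcon
  rw [not_or] at hcon
  have hAI : A ∈ I := hI le_sup_left (hf.1 hAC)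
  have hCI : C ∈ I := hI le_sup_right (hf.1 hAC)
  have h1 : ∃ D ∈ ξ, A ⊓ D = ⊥ := by
    by_contra hn
    exact hcon.1 (h.mem_of_meets hI hAI fun D hD he => hn ⟨D, hD, he⟩)
  have h2 : ∃ D ∈ ξ, C ⊓ D = ⊥ := by
    by_contra hn
    exact hcon.2 (h.mem_of_meets hI hCI fun D hD he => hn ⟨D, hD, he⟩)
  obtain ⟨D, hD, hAD⟩ := h1
  obtain ⟨E, hE, hCE⟩ := h2
  have hmem := hf.inf_mem hI hAC (hf.inf_mem hI hD hE)
  have hbot : (A ⊔ C) ⊓ (D ⊓ E) = ⊥ := by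
    rw [inf_sup_right, sup_eq_bot_iff]
    constructor
    · exact le_bot_iff.1 (hAD ▸ inf_le_inf_left _ inf_le_left)
    · exact le_bot_iff.1 (hCE ▸ inf_le_inf_left _ inf_le_right)
  exact hf.2.2.1 (hbot ▸ hmem)

/-- Prime filters are ultrafilters. -/
theorem IsFilterIn.isUltrafilterIn (hI : IsLowerSet I) (h : IsFilterIn I ξ)
    (hp : ∀ A C, A ⊔ C ∈ ξ → A ∈ ξ ∨ C ∈ ξ) : IsUltrafilterIn I ξ := by
  refine ⟨h, fun ζ hζ hle Z hZ => ?_⟩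
  obtain ⟨C, hC⟩ := h.2.1
  have hC' : C ⊓ Z ⊔ C \ Z ∈ ξ := by rwa [sup_comm, sup_sdiff_inf]
  rcases hp _ _ hC' with h1 | h1
  · exact h.2.2.2.1 _ h1 _ (hζ.1 hZ) inf_le_right
  · exfalso
    have h2 := hζ.inf_mem hI (hle h1) hZ
    rw [inf_comm, inf_sdiff_self_right] at h2
    exact hζ.2.2.1 h2

/-- The trace `ξ ∩ J` on an ideal `J ⊆ I` that meets an ultrafilter `ξ` of `I`
is an ultrafilter of `J`. -/
theorem IsUltrafilterIn.trace {J : Set B} (hI : IsLowerSet I) (hJ : IsLowerSet J)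
    (hJI : J ⊆ I) (h : IsUltrafilterIn I ξ) (hne : (ξ ∩ J).Nonempty) :
    IsUltrafilterIn J (ξ ∩ J) := by
  refine IsFilterIn.isUltrafilterIn hJ ⟨Set.inter_subset_right, hne, fun hb => h.1.2.2.1 hb.1,
    fun A hA C hC hle => ⟨h.1.2.2.2.1 A hA.1 C (hJI hC) hle, hC⟩, fun A hA C hC =>
    ⟨A ⊓ C, ⟨h.1.inf_mem hI hA.1 hC.1, hJ inf_le_left hA.2⟩, inf_le_left, inf_le_right⟩⟩ ?_
  rintro A C ⟨h1, h2⟩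
  rcases h.mem_or_mem hI h1 with h3 | h3
  · exact Or.inl ⟨h3, hJ le_sup_left h2⟩
  · exact Or.inr ⟨h3, hJ le_sup_right h2⟩

/-- The upper set in `B` generated by an ultrafilter of an ideal is an ultrafilter of `B`. -/
theorem IsUltrafilterIn.up (hI : IsLowerSet I) (h : IsUltrafilterIn I ξ) :
    IsUltrafilterIn Set.univ {A : B | ∃ C ∈ ξ, C ≤ A} := by
  have hf := h.1
  refine IsFilterIn.isUltrafilterIn (isLowerSet_univ) ⟨Set.subset_univ _, ?_, ?_, ?_, ?_⟩ ?_
  · obtain ⟨C, hC⟩ := hf.2.1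
    exact ⟨C, C, hC, le_rfl⟩
  · rintro ⟨C, hC, hle⟩
    exact hf.2.2.1 (le_bot_iff.1 hle ▸ hC)
  · rintro A ⟨C, hC, hle⟩ D - hAD
    exact ⟨C, hC, hle.trans hAD⟩
  · rintro A ⟨C, hC, hle⟩ D ⟨E, hE, hle'⟩
    obtain ⟨F, hF, h1, h2⟩ := hf.2.2.2.2 C hC E hE
    exact ⟨F, ⟨F, hF, le_rfl⟩, h1.trans hle, h2.trans hle'⟩
  · rintro A D ⟨C, hC, hle⟩
    have hC' : C ⊓ A ⊔ C ⊓ D ∈ ξ := by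
      rw [← inf_sup_left, inf_eq_left.2 hle]; exact hC
    rcases h.mem_or_mem hI hC' with h1 | h1
    · exact Or.inl ⟨_, h1, inf_le_right⟩
    · exact Or.inr ⟨_, h1, inf_le_right⟩

end Filters

/-! ## Boolean dynamical systems -/

/-- A Boolean dynamical system: a family of actions `θ a`, `a : L`, on a Boolean algebra `B`
(which need not have a largest element). -/
structure BooleanDynamicalSystem (B : Type u) (L : Type v) [GeneralizedBooleanAlgebra B] where
  θ : L → B → B
  map_bot : ∀ a, θ a ⊥ = ⊥
  map_inf : ∀ a A C, θ a (A ⊓ C) = θ a A ⊓ θ a C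
  map_sup : ∀ a A C, θ a (A ⊔ C) = θ a A ⊔ θ a C
  map_sdiff : ∀ a A C, θ a (A \ C) = θ a A \ θ a C

/-- A generalized Boolean dynamical system: a Boolean dynamical system with a family of ideals
`ideal a` such that `θ a` takes values in `ideal a`. -/
structure GenBooleanDynamicalSystem (B : Type u) (L : Type v) [GeneralizedBooleanAlgebra B]
    extends BooleanDynamicalSystem B L where
  ideal : L → Order.Ideal B
  θ_mem : ∀ a A, θ a A ∈ ideal a

variable {B : Type u} {L : Type v} [GeneralizedBooleanAlgebra B]

namespace BooleanDynamicalSystem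

variable (S : BooleanDynamicalSystem B L)

/-- The action of a word: `θ_{a₁ ⋯ aₙ} = θ_{aₙ} ∘ ⋯ ∘ θ_{a₁}`. -/
def θw : List L → B → B
  | [], A => A
  | a :: w, A => θw w (S.θ a A)

/-- `Δ_A = {a | θ_a(A) ≠ ∅}`. -/
def Δ (A : B) : Set L := {a | S.θ a A ≠ ⊥}

/-- `A` is regular if `0 < |Δ_C| < ∞` for all nonempty `C ⊆ A`. -/
def IsRegular (A : B) : Prop :=
  ∀ C : B, C ≠ ⊥ → C ≤ A → (S.Δ C).Nonempty ∧ (S.Δ C).Finite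

/-- `(α, A)` is a cycle: `α` is a nonempty word, `A ≠ ∅`, and `θ_α(C) = C` for all `C ⊆ A`. -/
def IsCycle (α : List L) (A : B) : Prop :=
  α ≠ [] ∧ A ≠ ⊥ ∧ ∀ C ≤ A, S.θw α C = C

/-- The pair `(α, A)`, `α = α₁ ⋯ αₙ`, has no exits: for all `1 ≤ t ≤ n` and all nonempty
`C ⊆ θ_{α₁ ⋯ α_t}(A)`, the element `C` is regular and `Δ_C = {α_{t+1}}`, where `α_{n+1} = α₁`.
Since lists are indexed from `0`, the letter `α_{t+1}` is the entry with index `t % n`. -/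
def HasNoExits (α : List L) (A : B) : Prop :=
  ∀ t : ℕ, 1 ≤ t → t ≤ α.length → ∀ C : B, C ≠ ⊥ → C ≤ S.θw (α.take t) A →
    S.IsRegular C ∧ ∃ a, α[t % α.length]? = some a ∧ S.Δ C = {a}

/-- Condition (L): there is no cycle without exits. -/
def ConditionL : Prop :=
  ¬ ∃ (α : List L) (A : B), S.IsCycle α A ∧ S.HasNoExits α A

end BooleanDynamicalSystem

/-! ## The topological correspondence -/

/-- The space of vertices `E⁰`: the Stone dual of `B`. -/
abbrev Vertex (B : Type u) [GeneralizedBooleanAlgebra B] : Type u := Stone (Set.univ : Set B)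

/-- The underlying subset of `B` of a point of `F⁰ = E⁰ ∪ {∅}`. The extra point is the empty set.
As a topological space `F⁰` is `OnePoint (Vertex B)`: the extra point is the point at infinity,
and it is isolated if `E⁰` is compact, that is, if `B` has a largest element. -/
def vset (x : OnePoint (Vertex B)) : Set B := x.elim ∅ fun χ => χ.1

theorem vset_coe (χ : Vertex B) : vset (χ : OnePoint (Vertex B)) = χ.1 := rfl

theorem vset_injective : Function.Injective (vset : OnePoint (Vertex B) → Set B) := by
  intro x y h
  induction x using OnePoint.rec with
  | infty =>
    induction y using OnePoint.rec with
    | infty => rfl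
    | coe y => exact absurd h.symm y.2.1.2.1.ne_empty
  | coe x =>
    induction y using OnePoint.rec with
    | infty => exact absurd h x.2.1.2.1.ne_empty
    | coe y => exact congrArg _ (Stone.ext h)

theorem exists_coe_of_nonempty {x : OnePoint (Vertex B)} (h : (vset x).Nonempty) :
    ∃ χ : Vertex B, x = χ := by
  induction x using OnePoint.rec with
  | infty => exact absurd h (by simp [vset])
  | coe x => exact ⟨x, rfl⟩

namespace GenBooleanDynamicalSystem

variable (S : GenBooleanDynamicalSystem B L)

/-- The ideal `I_α` of a word: `I_∅ = B`, and `I_{a₁ ⋯ aₙ}` consists of the elements below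
`θ_{a₂ ⋯ aₙ}(C)` for some `C ∈ I_{a₁}`. -/
def wordIdeal : List L → Set B
  | [] => Set.univ
  | a :: w => {A | ∃ C ∈ S.ideal a, A ≤ S.θw w C}

/-- The set `W*` of the words `α` with `I_α ≠ {∅}`. -/
def words : Set (List L) := {α | S.wordIdeal α ≠ {⊥}}

/-- The edges `e^a_η`, where `a` is a letter and `η` is an ultrafilter of the ideal `I_a`. -/
structure Edge where
  label : L
  filt : Stone (S.ideal label : Set B)

/-- The topology of `E¹`, generated by the sets `Z¹(a, A)` for `A ∈ I_a`. -/
instance : TopologicalSpace S.Edge :=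
  TopologicalSpace.generateFrom
    {s | ∃ a : L, ∃ A ∈ S.ideal a, s = {e : S.Edge | e.label = a ∧ A ∈ e.filt.1}}

variable {S}

theorem θ_mono (a : L) {A C : B} (h : A ≤ C) : S.θ a A ≤ S.θ a C := by
  rw [← inf_eq_left, ← S.map_inf, inf_eq_left.2 h]

theorem θw_mono (w : List L) {A C : B} (h : A ≤ C) : S.θw w A ≤ S.θw w C := by
  induction w generalizing A C with
  | nil => exact h
  | cons a w ih => exact ih (θ_mono a h)

theorem isLowerSet_ideal (a : L) : IsLowerSet (S.ideal a : Set B) := (S.ideal a).lower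

/-- The map `d : E¹ → E⁰`, `d(e^a_η) = ↑η`. -/
def Edge.d (e : S.Edge) : Vertex B :=
  ⟨{A | ∃ C ∈ e.filt.1, C ≤ A}, e.filt.2.up (isLowerSet_ideal e.label)⟩

theorem Edge.isUltrafilterIn_pullback (e : S.Edge)
    (h : {A : B | S.θ e.label A ∈ e.filt.1}.Nonempty) :
    IsUltrafilterIn Set.univ {A : B | S.θ e.label A ∈ e.filt.1} := by
  have hI := isLowerSet_ideal (S := S) e.label
  have hf := e.filt.2.1
  refine IsFilterIn.isUltrafilterIn isLowerSet_univ ⟨Set.subset_univ _, h, ?_, ?_, ?_⟩ ?_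
  · intro hb
    rw [Set.mem_ofPred_eq, S.map_bot] at hb
    exact hf.2.2.1 hb
  · intro A hA C _ hle
    exact hf.2.2.2.1 _ hA _ (S.θ_mem _ _) (θ_mono _ hle)
  · intro A hA C hC
    refine ⟨A ⊓ C, ?_, inf_le_left, inf_le_right⟩
    rw [Set.mem_ofPred_eq, S.map_inf]
    exact hf.inf_mem hI hA hC
  · intro A C hAC
    rw [Set.mem_ofPred_eq, S.map_sup] at hAC
    exact e.filt.2.mem_or_mem hI hAC

open Classical in
/-- The map `r : E¹ → F⁰`, `r(e^a_η) = {A | θ_a(A) ∈ η}`, which is an ultrafilter or empty. -/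
noncomputable def Edge.r (e : S.Edge) : OnePoint (Vertex B) :=
  if h : {A : B | S.θ e.label A ∈ e.filt.1}.Nonempty then
    OnePoint.some (X := Vertex B)
      ⟨{A | S.θ e.label A ∈ e.filt.1}, e.isUltrafilterIn_pullback h⟩
  else OnePoint.infty

theorem Edge.vset_r (e : S.Edge) : vset e.r = {A | S.θ e.label A ∈ e.filt.1} := by
  unfold Edge.r
  split_ifs with h
  · rfl
  · exact (Set.not_nonempty_iff_eq_empty.1 h).symm

theorem Edge.filt_eq (e : S.Edge) : e.filt.1 = e.d.1 ∩ S.ideal e.label := by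
  ext A
  constructor
  · intro h
    exact ⟨⟨A, h, le_rfl⟩, e.filt.2.1.1 h⟩
  · rintro ⟨⟨C, hC, hle⟩, hA⟩
    exact e.filt.2.1.2.2.2.1 C hC A hA hle

theorem Edge.ext_of_d {e e' : S.Edge} (hl : e.label = e'.label) (hd : e.d = e'.d) : e = e' := by
  have h1 := e.filt_eq
  have h2 := e'.filt_eq
  cases e with
  | mk a η =>
    cases e' with
    | mk a' η' =>
      obtain rfl : a = a' := hl
      congr 1
      apply Stone.ext
      rw [hd] at h1
      exact h1.trans h2.symm

/-- The edge with label `a` and `d`-image `χ`, for an ultrafilter `χ` that meets `I_a`;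
its ultrafilter of `I_a` is `χ ∩ I_a`. -/
def edgeTo (a : L) (χ : Vertex B) (h : (χ.1 ∩ S.ideal a).Nonempty) : S.Edge where
  label := a
  filt := ⟨χ.1 ∩ S.ideal a,
    χ.2.trace isLowerSet_univ (isLowerSet_ideal a) (Set.subset_univ _) h⟩

theorem edgeTo_d (a : L) (χ : Vertex B) (h : (χ.1 ∩ S.ideal a).Nonempty) :
    (edgeTo (S := S) a χ h).d = χ := by
  apply Stone.ext
  ext A
  constructor
  · rintro ⟨C, hC, hle⟩
    exact χ.2.1.2.2.2.1 C hC.1 A (Set.mem_univ _) hle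
  · intro hA
    obtain ⟨C, hC, hCI⟩ := h
    exact ⟨A ⊓ C, ⟨χ.2.1.inf_mem isLowerSet_univ hA hC, (S.ideal a).lower inf_le_right hCI⟩,
      inf_le_left⟩

variable (S)

/-- `F⁰_sce`, the complement of the closure of `r(E¹)`. -/
def sourceSet : Set (OnePoint (Vertex B)) := (closure (Set.range (Edge.r (S := S))))ᶜ

/-- `F⁰_fin`, the points with a neighbourhood `V` such that `r⁻¹(V)` is compact. -/
def finSet : Set (OnePoint (Vertex B)) :=
  {x | ∃ V ∈ nhds x, IsCompact ((Edge.r (S := S)) ⁻¹' V)}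

/-- `F⁰_rg`, the regular points. -/
def regSet : Set (OnePoint (Vertex B)) := S.finSet \ closure S.sourceSet

/-- `E⁰_sg`, the singular vertices. -/
def singularVertices : Set (Vertex B) := {χ | (χ : OnePoint (Vertex B)) ∉ S.regSet}

/-! ## Path spaces -/

/-- `E^{n+1}`, the paths of length `n + 1`, as a subspace of a product of copies of `E¹`. -/
abbrev PosPath (n : ℕ) : Type (max u v) :=
  {p : Fin (n + 1) → S.Edge //
    ∀ i : Fin n, ((p i.castSucc).d : OnePoint (Vertex B)) = (p i.succ).r}

/-- The finite path space `E*`, the topological disjoint union of `E⁰` and the `E^{n+1}`. -/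
abbrev FinPath : Type (max u v) := Vertex B ⊕ (Σ n : ℕ, S.PosPath n)

/-- The infinite path space. -/
abbrev InfPath : Type (max u v) :=
  {p : ℕ → S.Edge // ∀ i : ℕ, ((p i).d : OnePoint (Vertex B)) = (p (i + 1)).r}

variable {S}

/-- The map `d` on finite paths. -/
def FinPath.d : S.FinPath → Vertex B
  | Sum.inl χ => χ
  | Sum.inr ⟨n, p⟩ => (p.1 (Fin.last n)).d

variable (S)

/-- The boundary path space `∂E`: the infinite paths, and the finite paths `μ` for which `d(μ)`
is a singular vertex. -/
def BoundaryPath : Type (max u v) :=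
  S.InfPath ⊕ {μ : S.FinPath // FinPath.d μ ∈ S.singularVertices}

variable {S}

namespace BoundaryPath

/-- The range of a boundary path. -/
noncomputable def r : S.BoundaryPath → OnePoint (Vertex B)
  | Sum.inl p => (p.1 0).r
  | Sum.inr ⟨Sum.inl χ, _⟩ => (χ : OnePoint (Vertex B))
  | Sum.inr ⟨Sum.inr ⟨_, p⟩, _⟩ => (p.1 0).r

/-- The edge with index `i` (counted from `0`) of a boundary path, if there is one. -/
def edge : S.BoundaryPath → ℕ → Option S.Edge
  | Sum.inl p, i => some (p.1 i)
  | Sum.inr ⟨Sum.inl _, _⟩, _ => none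
  | Sum.inr ⟨Sum.inr ⟨n, p⟩, _⟩, i => if h : i < n + 1 then some (p.1 ⟨i, h⟩) else none

end BoundaryPath

/-- `𝒵(X)` for a set `X` of finite paths: the boundary paths `μ` such that `r(μ) ∈ X` or such that
some initial segment of `μ` of positive length belongs to `X`. -/
def cylinder (X : Set S.FinPath) : Set S.BoundaryPath :=
  {μ | (∃ χ : Vertex B, μ.r = (χ : OnePoint (Vertex B)) ∧ Sum.inl χ ∈ X) ∨
    ∃ (n : ℕ) (p : S.PosPath n), Sum.inr ⟨n, p⟩ ∈ X ∧
      ∀ i : Fin (n + 1), μ.edge i = some (p.1 i)}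

/-- The topology of `∂E`, generated by the sets `𝒵(U) \ 𝒵(K)` with `U` open and `K` compact. -/
instance : TopologicalSpace S.BoundaryPath :=
  TopologicalSpace.generateFrom
    {s | ∃ U K : Set S.FinPath, IsOpen U ∧ IsCompact K ∧ s = cylinder U ∩ (cylinder K)ᶜ}

namespace BoundaryPath

/-- Remove the first edge of a boundary path of positive length
(a path of length `0` is left unchanged). -/
def tail : S.BoundaryPath → S.BoundaryPath
  | Sum.inl p => Sum.inl ⟨fun i => p.1 (i + 1), fun i => p.2 (i + 1)⟩
  | Sum.inr ⟨Sum.inl χ, h⟩ => Sum.inr ⟨Sum.inl χ, h⟩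
  | Sum.inr ⟨Sum.inr ⟨0, p⟩, h⟩ => Sum.inr ⟨Sum.inl (p.1 0).d, h⟩
  | Sum.inr ⟨Sum.inr ⟨_ + 1, p⟩, h⟩ =>
      Sum.inr ⟨Sum.inr ⟨_, ⟨fun i => p.1 i.succ, fun i => p.2 i.succ⟩⟩, h⟩

/-- The concatenation `e ν` of an edge `e` and a boundary path `ν` with `d(e) = r(ν)`. -/
def cons (e : S.Edge) : (ν : S.BoundaryPath) → (e.d : OnePoint (Vertex B)) = ν.r → S.BoundaryPath
  | Sum.inl p, h => Sum.inl ⟨fun i => Nat.casesOn i e p.1, fun i => by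
      cases i with
      | zero => exact h
      | succ i => exact p.2 i⟩
  | Sum.inr ⟨Sum.inl χ, hχ⟩, h => Sum.inr ⟨Sum.inr ⟨0, ⟨fun _ => e, fun i => i.elim0⟩⟩, by
      have h' : e.d = χ := OnePoint.coe_injective h
      change e.d ∈ _
      rw [h']
      exact hχ⟩
  | Sum.inr ⟨Sum.inr ⟨n, p⟩, hp⟩, h =>
      Sum.inr ⟨Sum.inr ⟨n + 1, ⟨Fin.cons e p.1, fun i => by
        cases i using Fin.cases with
        | zero => exact h
        | succ i => exact p.2 i⟩⟩, hp⟩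

theorem edge_cons_zero (e : S.Edge) (ν : S.BoundaryPath) (h) : (cons e ν h).edge 0 = some e := by
  rcases ν with p | ⟨χ | ⟨n, p⟩, hp⟩ <;> simp [cons, edge]

theorem edge_tail (μ : S.BoundaryPath) (i : ℕ) : μ.tail.edge i = μ.edge (i + 1) := by
  rcases μ with p | ⟨χ | ⟨n | n, p⟩, hp⟩ <;> simp [tail, edge]

theorem tail_cons (e : S.Edge) (ν : S.BoundaryPath) (h) : (cons e ν h).tail = ν := by
  rcases ν with p | ⟨χ | ⟨n, p⟩, hp⟩
  · rfl
  · have h' : e.d = χ := OnePoint.coe_injective h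
    subst h'
    rfl
  · rfl

theorem r_cons (e : S.Edge) (ν : S.BoundaryPath) (h) : (cons e ν h).r = e.r := by
  rcases ν with p | ⟨χ | ⟨n, p⟩, hp⟩ <;> rfl

theorem exists_eq_cons {e : S.Edge} {μ : S.BoundaryPath} (h : μ.edge 0 = some e) :
    ∃ hr, μ = cons e μ.tail hr := by
  rcases μ with p | ⟨χ | ⟨n | n, p⟩, hp⟩
  · obtain rfl : p.1 0 = e := by simpa [edge] using h
    refine ⟨p.2 0, ?_⟩
    refine congrArg Sum.inl (Subtype.ext ?_)
    funext i
    cases i <;> rfl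
  · simp [edge] at h
  · obtain rfl : p.1 0 = e := by simpa [edge] using h
    refine ⟨rfl, ?_⟩
    refine congrArg Sum.inr (Subtype.ext ?_)
    refine congrArg Sum.inr (congrArg (Sigma.mk 0) (Subtype.ext ?_))
    funext i
    rw [Fin.fin_one_eq_zero i]
  · obtain rfl : p.1 0 = e := by simpa [edge] using h
    refine ⟨p.2 0, ?_⟩
    refine congrArg Sum.inr (Subtype.ext ?_)
    refine congrArg Sum.inr (congrArg (Sigma.mk (n + 1)) (Subtype.ext ?_))
    funext i
    cases i using Fin.cases <;> rfl

/-- The first `|w|` letters of `𝒫(μ)` form the word `w`. -/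
def StartsWith (w : List L) (μ : S.BoundaryPath) : Prop :=
  ∀ (i : ℕ) (h : i < w.length), ∃ e, μ.edge i = some e ∧ e.label = w[i]

/-- The ultrafilter `η_k` of the `k`-th edge of `μ` (counted from `1`) as a subset of `B`;
for `k = 0`, the subset `r(μ)` of `B`. -/
noncomputable def filterAt (μ : S.BoundaryPath) : ℕ → Set B
  | 0 => vset μ.r
  | k + 1 => (μ.edge k).elim ∅ fun e => e.filt.1

theorem startsWith_cons {a : L} {w : List L} {μ : S.BoundaryPath} :
    StartsWith (a :: w) μ ↔ (∃ e, μ.edge 0 = some e ∧ e.label = a) ∧ StartsWith w μ.tail := by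
  constructor
  · intro h
    refine ⟨h 0 (by simp), fun i hi => ?_⟩
    obtain ⟨e, he, hl⟩ := h (i + 1) (by simpa using hi)
    exact ⟨e, by rw [edge_tail, he], by simpa using hl⟩
  · rintro ⟨h0, h⟩ i hi
    cases i with
    | zero => exact h0
    | succ i =>
      obtain ⟨e, he, hl⟩ := h i (by simpa using hi)
      exact ⟨e, by rw [← edge_tail, he], by simpa using hl⟩

/-- `μ` begins with the word `w`, and `ν` is what remains of `μ` after the first `|w|` edges. -/
def Extends (w : List L) (ν μ : S.BoundaryPath) : Prop :=
  StartsWith w μ ∧ tail^[w.length] μ = ν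

theorem extends_nil {ν μ : S.BoundaryPath} : Extends [] ν μ ↔ μ = ν := by
  simp [Extends, StartsWith]

theorem extends_cons {a : L} {w : List L} {ν μ : S.BoundaryPath} :
    Extends (a :: w) ν μ ↔ ∃ e κ h, μ = cons e κ h ∧ e.label = a ∧ Extends w ν κ := by
  constructor
  · rintro ⟨h1, h2⟩
    obtain ⟨⟨e, he, hl⟩, h3⟩ := startsWith_cons.1 h1
    obtain ⟨hr, hμ⟩ := exists_eq_cons he
    exact ⟨e, μ.tail, hr, hμ, hl, h3, h2⟩
  · rintro ⟨e, κ, h, rfl, hl, h1, h2⟩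
    refine ⟨startsWith_cons.2 ⟨⟨e, edge_cons_zero _ _ _, hl⟩, ?_⟩, ?_⟩
    · rwa [tail_cons]
    · rw [List.length_cons, Function.iterate_succ_apply, tail_cons, h2]

theorem extends_append {u w : List L} {ν μ : S.BoundaryPath} :
    Extends (u ++ w) ν μ ↔ ∃ κ, Extends u κ μ ∧ Extends w ν κ := by
  induction u generalizing μ with
  | nil => simp [extends_nil]
  | cons a u ih =>
    simp only [List.cons_append, extends_cons, ih]
    constructor
    · rintro ⟨e, κ, h, hμ, hl, κ', h1, h2⟩
      exact ⟨κ', ⟨e, κ, h, hμ, hl, h1⟩, h2⟩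
    · rintro ⟨κ', ⟨e, κ, h, hμ, hl, h1⟩, h2⟩
      exact ⟨e, κ, h, hμ, hl, κ', h1, h2⟩

theorem vset_r_cons (e : S.Edge) (ν : S.BoundaryPath) (h) :
    vset (cons e ν h).r = {A | S.θ e.label A ∈ vset ν.r} := by
  rw [r_cons, e.vset_r, e.filt_eq, ← h, vset_coe]
  ext A
  exact ⟨fun hA => hA.1, fun hA => ⟨hA, S.θ_mem _ _⟩⟩

theorem Extends.vset_r {w : List L} {ν μ : S.BoundaryPath} (h : Extends w ν μ) :
    vset μ.r = {A | S.θw w A ∈ vset ν.r} := by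
  induction w generalizing μ with
  | nil => rw [extends_nil] at h; subst h; rfl
  | cons a w ih =>
    obtain ⟨e, κ, hr, rfl, rfl, h1⟩ := extends_cons.1 h
    rw [vset_r_cons, ih h1]
    rfl

theorem Extends.nonempty {w : List L} {ν μ : S.BoundaryPath} (h : Extends w ν μ)
    (hw : w ≠ []) : (vset ν.r ∩ S.wordIdeal w).Nonempty := by
  cases w with
  | nil => exact absurd rfl hw
  | cons a w =>
    obtain ⟨e, κ, hr, rfl, rfl, h1⟩ := extends_cons.1 h
    obtain ⟨C, hC⟩ := e.filt.2.1.2.1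
    have hC' := hC
    rw [e.filt_eq] at hC'
    refine ⟨S.θw w C, ?_, C, hC'.2, le_rfl⟩
    have h2 : C ∈ vset κ.r := by rw [← hr]; exact hC'.1
    rw [h1.vset_r] at h2
    exact h2

theorem vset_upper {x : OnePoint (Vertex B)} {A C : B} (hA : A ∈ vset x) (h : A ≤ C) :
    C ∈ vset x := by
  obtain ⟨χ, rfl⟩ := exists_coe_of_nonempty ⟨A, hA⟩
  exact χ.2.1.2.2.2.1 A hA C (Set.mem_univ _) h

theorem vset_inf {x : OnePoint (Vertex B)} {A C : B} (hA : A ∈ vset x) (hC : C ∈ vset x) :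
    A ⊓ C ∈ vset x := by
  obtain ⟨χ, rfl⟩ := exists_coe_of_nonempty ⟨A, hA⟩
  exact χ.2.1.inf_mem isLowerSet_univ hA hC

theorem bot_notMem_vset (x : OnePoint (Vertex B)) : ⊥ ∉ vset x := by
  intro h
  obtain ⟨χ, rfl⟩ := exists_coe_of_nonempty ⟨_, h⟩
  exact χ.2.1.2.2.1 h

theorem isLowerSet_wordIdeal (w : List L) : IsLowerSet (S.wordIdeal w) := by
  cases w with
  | nil => exact isLowerSet_univ
  | cons a w =>
    rintro A C hle ⟨D, hD, h⟩
    exact ⟨D, hD, hle.trans h⟩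

open Classical in
/-- The path `e^a_η ν` with `η = r(ν) ∩ I_a`, that is, `η = g_{(a)∅}(r(ν))`, for a boundary path `ν`
such that `r(ν)` meets `I_a` (for the other `ν` the value is irrelevant). -/
noncomputable def prependLetter (a : L) (ν : S.BoundaryPath) : S.BoundaryPath :=
  if h : ∃ χ : Vertex B, ν.r = (χ : OnePoint (Vertex B)) ∧ (χ.1 ∩ S.ideal a).Nonempty then
    cons (edgeTo a h.choose h.choose_spec.2) ν 
      ((congrArg _ (edgeTo_d _ _ _)).trans h.choose_spec.1.symm)
  else ν

/-- The path `e^{α₁}_{η₁} ⋯ e^{αₙ}_{ηₙ} ν`, where the ultrafilters are determined successively by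
`ηₙ = g_{(αₙ)∅}(r(ν))` and `ηᵢ = g_{(αᵢ)∅}(r(e^{αᵢ₊₁}_{ηᵢ₊₁}))` for `i < n`. -/
noncomputable def prependWord (w : List L) (ν : S.BoundaryPath) : S.BoundaryPath :=
  w.foldr prependLetter ν

theorem prependLetter_eq_cons {e : S.Edge} {ν : S.BoundaryPath} (h) :
    prependLetter e.label ν = cons e ν h := by
  have hex : ∃ χ : Vertex B, ν.r = (χ : OnePoint (Vertex B)) ∧
      (χ.1 ∩ S.ideal e.label).Nonempty := by
    refine ⟨e.d, h.symm, ?_⟩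
    rw [← e.filt_eq]
    exact e.filt.2.1.2.1
  have he : edgeTo e.label hex.choose hex.choose_spec.2 = e := by
    refine Edge.ext_of_d rfl ?_
    rw [edgeTo_d]
    exact OnePoint.coe_injective (hex.choose_spec.1.symm.trans h.symm)
  unfold prependLetter
  rw [dif_pos hex]
  congr 1

theorem Extends.eq_prependWord {w : List L} {ν μ : S.BoundaryPath} (h : Extends w ν μ) :
    μ = prependWord w ν := by
  induction w generalizing μ with
  | nil => exact extends_nil.1 h
  | cons a w ih =>
    obtain ⟨e, κ, hr, rfl, rfl, h1⟩ := extends_cons.1 h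
    change _ = prependLetter e.label (prependWord w ν)
    rw [← ih h1, prependLetter_eq_cons hr]

theorem extends_prependWord {w : List L} {ν : S.BoundaryPath}
    (h : (vset ν.r ∩ S.wordIdeal w).Nonempty) : Extends w ν (prependWord w ν) := by
  induction w with
  | nil => exact extends_nil.2 rfl
  | cons a w ih =>
    obtain ⟨A, hA, C, hC, hle⟩ := h
    have h1 : S.θw w C ∈ vset ν.r := vset_upper hA hle
    have h2 : (vset ν.r ∩ S.wordIdeal w).Nonempty := by
      cases w with
      | nil => exact ⟨A, hA, Set.mem_univ _⟩
      | cons b w => exact ⟨_, h1, _, S.θ_mem b C, le_rfl⟩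
    have h3 := ih h2
    have h4 : C ∈ vset (prependWord w ν).r := by
      rw [h3.vset_r]; exact h1
    obtain ⟨χ, hχ⟩ := exists_coe_of_nonempty ⟨C, h4⟩
    have h5 : (χ.1 ∩ S.ideal a).Nonempty := ⟨C, by rw [← vset_coe, ← hχ]; exact h4, hC⟩
    have h6 : ((edgeTo (S := S) a χ h5).d : OnePoint (Vertex B)) = (prependWord w ν).r := by
      rw [edgeTo_d, hχ]
    exact extends_cons.2 ⟨_, _, h6, prependLetter_eq_cons h6, rfl, h3⟩

theorem vset_r_tail_of_edge {k : ℕ} {μ : S.BoundaryPath} {e : S.Edge} (h : μ.edge k = some e) :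
    vset (tail^[k + 1] μ).r = e.d.1 := by
  induction k generalizing μ with
  | zero =>
    obtain ⟨hr, -⟩ := exists_eq_cons h
    change vset μ.tail.r = _
    rw [← hr, vset_coe]
  | succ k ih =>
    rw [Function.iterate_succ_apply]
    exact ih (by rw [edge_tail, h])

theorem Extends.filterAt_inter_nonempty {α β : List L} {ν μ : S.BoundaryPath}
    (h : Extends α ν μ) :
    (filterAt μ α.length ∩ S.wordIdeal β).Nonempty ↔ (vset ν.r ∩ S.wordIdeal β).Nonempty := by
  obtain ⟨h1, rfl⟩ := h
  rcases hα : α.length with _ | k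
  · rfl
  · obtain ⟨e, he, -⟩ := h1 k (by omega)
    rw [vset_r_tail_of_edge he]
    simp only [filterAt, he, Option.elim_some]
    constructor
    · rintro ⟨A, hA, hAβ⟩
      exact ⟨A, ⟨A, hA, le_rfl⟩, hAβ⟩
    · rintro ⟨A, ⟨C, hC, hle⟩, hAβ⟩
      exact ⟨C, hC, isLowerSet_wordIdeal β hle hAβ⟩

end BoundaryPath

/-! ## The partial action of the free group -/

/-- The element of the free group given by a word. -/
def wordElt (w : List L) : FreeGroup L := (w.map FreeGroup.of).prod

/-- `α β⁻¹` is in reduced form: `α` and `β` do not end with the same letter. -/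
def IsReducedPair (α β : List L) : Prop := ∀ a ∈ α.getLast?, a ∉ β.getLast?

theorem IsReducedPair.symm {α β : List L} (h : IsReducedPair α β) : IsReducedPair β α :=
  fun a ha hb => h a hb ha

theorem wordElt_append (u w : List L) : wordElt (u ++ w) = wordElt u * wordElt w := by
  simp [wordElt]

theorem wordElt_eq_mk (w : List L) : wordElt w = FreeGroup.mk (w.map fun a => (a, true)) := by
  induction w with
  | nil => rfl
  | cons a w ih =>
    have : wordElt (a :: w) = FreeGroup.of a * wordElt w := by simp [wordElt]
    rw [this, ih, FreeGroup.of, FreeGroup.mul_mk]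
    rfl

theorem IsReducedPair.isReduced {α β : List L} (h : IsReducedPair α β) :
    FreeGroup.IsReduced (α.map (fun a => (a, true)) ++ β.reverse.map fun a => (a, false)) := by
  refine List.isChain_append.2 ⟨?_, ?_, ?_⟩
  · rw [List.isChain_map]
    exact List.Pairwise.isChain (List.pairwise_of_forall fun _ _ _ => rfl)
  · rw [List.isChain_map]
    exact List.Pairwise.isChain (List.pairwise_of_forall fun _ _ _ => rfl)
  · rintro ⟨a, b⟩ ha ⟨c, d⟩ hc hac
    simp only [List.getLast?_map, List.head?_map, List.head?_reverse, Option.mem_def,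
      Option.map_eq_some_iff, Prod.mk.injEq] at ha hc
    obtain ⟨a', ha', rfl, rfl⟩ := ha
    obtain ⟨c', hc', rfl, rfl⟩ := hc
    obtain rfl : a' = c' := hac
    exact absurd hc' (h _ ha')

/-- The reduced form `α β⁻¹` of an element of the free group is unique. -/
theorem IsReducedPair.unique {α β α' β' : List L} (h : IsReducedPair α β)
    (h' : IsReducedPair α' β')
    (he : wordElt α * (wordElt β)⁻¹ = wordElt α' * (wordElt β')⁻¹) : α = α' ∧ β = β' := by
  classical
  have key : ∀ u w : List L, wordElt u * (wordElt w)⁻¹ =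
      FreeGroup.mk (u.map (fun a => (a, true)) ++ w.reverse.map fun a => (a, false)) := by
    intro u w
    rw [wordElt_eq_mk, wordElt_eq_mk, FreeGroup.inv_mk, FreeGroup.mul_mk]
    simp [FreeGroup.invRev, Function.comp_def]
  rw [key, key] at he
  have hw := FreeGroup.reduce.sound he
  rw [h.isReduced.reduce_eq, h'.isReduced.reduce_eq] at hw
  constructor
  · have := congrArg (fun l => (l.filter (fun x => x.2)).map Prod.fst) hw
    simpa [List.filter_map, Function.comp_def] using this
  · have := congrArg (fun l => (l.filter (fun x => !x.2)).map Prod.fst) hw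
    simpa [List.filter_map, Function.comp_def] using this

variable (S)

/-- The set `U_{α β⁻¹}`, for `α, β ∈ W*` with `I_α ∩ I_β ≠ {∅}`: the boundary paths whose first
`|α|` letters form `α` and for which `η_{|α|}` meets `I_β`. -/
def wordDomain (α β : List L) : Set S.BoundaryPath :=
  {μ | α ∈ S.words ∧ β ∈ S.words ∧ S.wordIdeal α ∩ S.wordIdeal β ≠ {⊥} ∧
    μ.StartsWith α ∧ (μ.filterAt α.length ∩ S.wordIdeal β).Nonempty}

/-- The sets `U_t`: `U_1 = ∂E`; if `t = α β⁻¹` in reduced form then `U_t` is given by the words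
`α` and `β`; otherwise it is empty. -/
def U (t : FreeGroup L) : Set S.BoundaryPath :=
  {μ | t = 1 ∨ ∃ α β : List L, IsReducedPair α β ∧ t = wordElt α * (wordElt β)⁻¹ ∧
    μ ∈ S.wordDomain α β}

variable {S}

open Classical in
/-- The value `φ_t(μ)`: if `t = α β⁻¹` in reduced form, the first `|β|` edges of `μ` are removed and
replaced by edges with the labels `α`. The value is only used for `μ ∈ U_{t⁻¹}`. -/
noncomputable def move (t : FreeGroup L) (μ : S.BoundaryPath) : S.BoundaryPath :=
  if h : ∃ p : List L × List L, IsReducedPair p.1 p.2 ∧ t = wordElt p.1 * (wordElt p.2)⁻¹ then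
    BoundaryPath.prependWord h.choose.1 (BoundaryPath.tail^[h.choose.2.length] μ)
  else μ

theorem move_eq {α β : List L} (h : IsReducedPair α β) (μ : S.BoundaryPath) :
    move (wordElt α * (wordElt β)⁻¹) μ =
      BoundaryPath.prependWord α (BoundaryPath.tail^[β.length] μ) := by
  have hex : ∃ p : List L × List L, IsReducedPair p.1 p.2 ∧
      wordElt α * (wordElt β)⁻¹ = wordElt p.1 * (wordElt p.2)⁻¹ := ⟨(α, β), h, rfl⟩
  obtain ⟨h1, h2⟩ := h.unique hex.choose_spec.1 hex.choose_spec.2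
  unfold move
  rw [dif_pos hex, ← h1, ← h2]

/-- The relation `μ = α ν`, `κ = β ν`, `t = α β⁻¹` for some words `α`, `β` and some `ν`. It is
shown below to hold if and only if `μ ∈ U_t` and `φ_{t⁻¹}(μ) = κ`. -/
def Shift (t : FreeGroup L) (μ κ : S.BoundaryPath) : Prop :=
  ∃ (α β : List L) (ν : S.BoundaryPath), t = wordElt α * (wordElt β)⁻¹ ∧
    BoundaryPath.Extends α ν μ ∧ BoundaryPath.Extends β ν κ

theorem Shift.symm {t : FreeGroup L} {μ κ : S.BoundaryPath} (h : Shift t μ κ) :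
    Shift t⁻¹ κ μ := by
  obtain ⟨α, β, ν, rfl, h1, h2⟩ := h
  exact ⟨β, α, ν, by simp, h2, h1⟩

theorem Shift.refl (μ : S.BoundaryPath) : Shift 1 μ μ :=
  ⟨[], [], μ, by simp, BoundaryPath.extends_nil.2 rfl, BoundaryPath.extends_nil.2 rfl⟩

theorem BoundaryPath.Extends.split {α β : List L} {ν κ μ : S.BoundaryPath}
    (h1 : Extends α ν μ) (h2 : Extends β κ μ) (hle : α.length ≤ β.length) :
    ∃ γ, β = α ++ γ ∧ Extends γ κ ν := by
  have hβ : β = α ++ β.drop α.length := by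
    refine List.ext_getElem (by simp; omega) fun i hi hi' => ?_
    by_cases hlt : i < α.length
    · obtain ⟨e, he, hl⟩ := h1.1 i hlt
      obtain ⟨e', he', hl'⟩ := h2.1 i hi
      rw [he] at he'
      obtain rfl := Option.some.inj he'
      rw [← hl', hl, List.getElem_append_left hlt]
    · rw [List.getElem_append_right (by omega), List.getElem_drop]
      congr 1
      omega
  refine ⟨_, hβ, ?_⟩
  rw [hβ] at h2
  obtain ⟨ν', h3, h4⟩ := extends_append.1 h2
  rwa [← h1.2, h3.2]

theorem Shift.trans {t s : FreeGroup L} {μ κ ρ : S.BoundaryPath} (h : Shift t μ κ)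
    (h' : Shift s κ ρ) : Shift (t * s) μ ρ := by
  obtain ⟨α, β, ν, rfl, h1, h2⟩ := h
  obtain ⟨α', β', ν', rfl, h3, h4⟩ := h'
  rcases le_total β.length α'.length with hle | hle
  · obtain ⟨γ, rfl, hγ⟩ := h2.split h3 hle
    refine ⟨α ++ γ, β', ν', ?_, BoundaryPath.extends_append.2 ⟨ν, h1, hγ⟩, h4⟩
    rw [wordElt_append, wordElt_append]
    group
  · obtain ⟨γ, rfl, hγ⟩ := h3.split h2 hle
    refine ⟨α, β' ++ γ, ν, ?_, h1, BoundaryPath.extends_append.2 ⟨ν', h4, hγ⟩⟩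
    rw [wordElt_append, wordElt_append]
    group

theorem exists_reduced {n : ℕ} {α β : List L} (hn : α.length = n) {ν μ κ : S.BoundaryPath}
    (h1 : BoundaryPath.Extends α ν μ) (h2 : BoundaryPath.Extends β ν κ) :
    ∃ (α' β' : List L) (ν' : S.BoundaryPath), IsReducedPair α' β' ∧
      wordElt α * (wordElt β)⁻¹ = wordElt α' * (wordElt β')⁻¹ ∧
      BoundaryPath.Extends α' ν' μ ∧ BoundaryPath.Extends β' ν' κ := by
  induction n generalizing α β ν with
  | zero =>
    obtain rfl := List.length_eq_zero_iff.1 hn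
    exact ⟨[], β, ν, by simp [IsReducedPair], rfl, h1, h2⟩
  | succ n ih =>
    by_cases hr : IsReducedPair α β
    · exact ⟨α, β, ν, hr, rfl, h1, h2⟩
    · simp only [IsReducedPair, not_forall, not_not] at hr
      obtain ⟨a, ha, hb⟩ := hr
      obtain ⟨α₁, rfl⟩ := List.getLast?_eq_some_iff.1 ha
      obtain ⟨β₁, rfl⟩ := List.getLast?_eq_some_iff.1 hb
      obtain ⟨ν₁, h3, h4⟩ := BoundaryPath.extends_append.1 h1
      obtain ⟨ν₂, h5, h6⟩ := BoundaryPath.extends_append.1 h2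
      obtain rfl : ν₁ = ν₂ := h4.eq_prependWord.trans h6.eq_prependWord.symm
      obtain ⟨α', β', ν', h7, h8, h9⟩ := ih (by simpa using hn) h3 h5
      refine ⟨α', β', ν', h7, ?_, h9⟩
      rw [← h8, wordElt_append, wordElt_append]
      group

theorem mem_wordDomain_iff {α β : List L} (hne : ¬ (α = [] ∧ β = [])) {μ : S.BoundaryPath} :
    μ ∈ S.wordDomain α β ↔
      ∃ ν κ, BoundaryPath.Extends α ν μ ∧ BoundaryPath.Extends β ν κ := by
  constructor
  · rintro ⟨-, -, -, h1, h2⟩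
    have h3 : BoundaryPath.Extends α (BoundaryPath.tail^[α.length] μ) μ := ⟨h1, rfl⟩
    exact ⟨_, _, h3, BoundaryPath.extends_prependWord (h3.filterAt_inter_nonempty.1 h2)⟩
  · rintro ⟨ν, κ, h1, h2⟩
    have hν : (vset ν.r).Nonempty := by
      by_cases hα : α = []
      · exact (h2.nonempty fun hβ => hne ⟨hα, hβ⟩).mono Set.inter_subset_left
      · exact (h1.nonempty hα).mono Set.inter_subset_left
    have aux : ∀ {w : List L} {ρ : S.BoundaryPath}, BoundaryPath.Extends w ν ρ →
        (vset ν.r ∩ S.wordIdeal w).Nonempty := by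
      intro w ρ h
      by_cases hw : w = []
      · subst hw
        exact hν.mono fun A hA => ⟨hA, Set.mem_univ _⟩
      · exact h.nonempty hw
    obtain ⟨A, hA, hAα⟩ := aux h1
    obtain ⟨C, hC, hCβ⟩ := aux h2
    have hD := BoundaryPath.vset_inf hA hC
    have hDα := BoundaryPath.isLowerSet_wordIdeal α (inf_le_left : A ⊓ C ≤ A) hAα
    have hDβ := BoundaryPath.isLowerSet_wordIdeal β (inf_le_right : A ⊓ C ≤ C) hCβ
    have hbot : A ⊓ C ≠ ⊥ := fun h => BoundaryPath.bot_notMem_vset _ (h ▸ hD)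
    have hsub : ∀ {X : Set B}, A ⊓ C ∈ X → X ≠ {⊥} := fun hX h => hbot (by rwa [h] at hX)
    refine ⟨hsub hDα, hsub hDβ, hsub ⟨hDα, hDβ⟩, h1.1, h1.filterAt_inter_nonempty.2 ⟨_, hD, hDβ⟩⟩

theorem shift_iff {t : FreeGroup L} {μ κ : S.BoundaryPath} :
    Shift t μ κ ↔ μ ∈ S.U t ∧ move t⁻¹ μ = κ := by
  constructor
  · rintro ⟨α, β, ν, rfl, h1, h2⟩
    obtain ⟨α', β', ν', hr, he, h3, h4⟩ := exists_reduced rfl h1 h2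
    rw [he]
    constructor
    · by_cases hne : α' = [] ∧ β' = []
      · left
        rw [hne.1, hne.2]
        simp
      · exact Or.inr ⟨α', β', hr, rfl, (mem_wordDomain_iff hne).2 ⟨ν', κ, h3, h4⟩⟩
    · rw [mul_inv_rev, inv_inv, move_eq hr.symm, h3.2]
      exact h4.eq_prependWord.symm
  · rintro ⟨h, rfl⟩
    have h1 : IsReducedPair ([] : List L) [] := by simp [IsReducedPair]
    by_cases ht : t = 1
    · have h2 : (t⁻¹ : FreeGroup L) = wordElt [] * (wordElt [])⁻¹ := by simp [ht]
      rw [h2, move_eq h1, ht]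
      exact Shift.refl μ
    · rcases h with h | ⟨α, β, hr, rfl, h⟩
      · exact absurd h ht
      · have hne : ¬ (α = [] ∧ β = []) := by
          rintro ⟨rfl, rfl⟩
          exact ht (by simp)
        obtain ⟨ν, κ, h3, h4⟩ := (mem_wordDomain_iff hne).1 h
        rw [mul_inv_rev, inv_inv, move_eq hr.symm, h3.2, ← h4.eq_prependWord]
        exact ⟨α, β, ν, rfl, h3, h4⟩

theorem shift_move {t : FreeGroup L} {μ : S.BoundaryPath} (h : μ ∈ S.U t⁻¹) :
    Shift t (move t μ) μ := by
  have := (shift_iff (t := t⁻¹) (μ := μ) (κ := move t μ)).2 ⟨h, by rw [inv_inv]⟩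
  simpa using this.symm

/-- The bijections `φ_t : U_{t⁻¹} → U_t` of the partial action. -/
noncomputable def φ (t : FreeGroup L) (μ : S.U t⁻¹) : S.U t :=
  ⟨move t μ.1, (shift_iff.1 (shift_move μ.2)).1⟩

variable (S)

/-- `Fix(t)`, the set of the `μ ∈ U_{t⁻¹}` with `φ_t(μ) = μ`. -/
def fixedPoints (t : FreeGroup L) : Set S.BoundaryPath :=
  {μ | ∃ h : μ ∈ S.U t⁻¹, (φ t ⟨μ, h⟩ : S.BoundaryPath) = μ}

/-- The partial action is topologically free: `Fix(t)` has empty interior for all `t ≠ 1`. -/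
def TopologicallyFree : Prop :=
  ∀ t : FreeGroup L, t ≠ 1 → interior (S.fixedPoints t) = ∅

end GenBooleanDynamicalSystem

/-! ## Groupoids -/

/-- A groupoid with set of arrows `G` and set of units `X`; the unit at `x` is `one x`. -/
structure GroupoidOn (G : Type*) (X : Type*) where
  r : G → X
  s : G → X
  one : X → G
  inv : G → G
  mul : (g h : G) → s g = r h → G
  r_one : ∀ x, r (one x) = x
  s_one : ∀ x, s (one x) = x
  r_inv : ∀ g, r (inv g) = s g
  s_inv : ∀ g, s (inv g) = r g
  r_mul : ∀ g h hgh, r (mul g h hgh) = r g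
  s_mul : ∀ g h hgh, s (mul g h hgh) = s h
  one_mul : ∀ g, mul (one (r g)) g (s_one _) = g
  mul_one : ∀ g, mul g (one (s g)) (r_one _).symm = g
  inv_mul : ∀ g, mul (inv g) g (s_inv g) = one (s g)
  mul_inv : ∀ g, mul g (inv g) (r_inv g).symm = one (r g)
  mul_assoc : ∀ g h k hgh hhk,
    mul (mul g h hgh) k ((s_mul g h hgh).trans hhk) =
      mul g (mul h k hhk) (hgh.trans (r_mul h k hhk).symm)

namespace GroupoidOn

variable {G X : Type*} (𝒢 : GroupoidOn G X)

/-- The isotropy group bundle. -/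
def iso : Set G := {g | 𝒢.s g = 𝒢.r g}

/-- The isotropy group `𝒢_x^x` at a unit. -/
def isotropyAt (x : X) : Set G := {g | 𝒢.r g = x ∧ 𝒢.s g = x}

/-- Topologically principal: the units with trivial isotropy are dense in the unit space. -/
def TopologicallyPrincipal [TopologicalSpace X] : Prop :=
  Dense {x : X | 𝒢.isotropyAt x = {𝒢.one x}}

/-- Effective: the interior of the isotropy group bundle is the set of units. -/
def Effective [TopologicalSpace G] : Prop :=
  interior 𝒢.iso = Set.range 𝒢.one

end GroupoidOn

namespace GenBooleanDynamicalSystem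

variable (S : GenBooleanDynamicalSystem B L)

/-- The set of arrows of the transformation groupoid: the pairs `(t, μ)` with `μ ∈ U_t`. -/
def Arrow : Type (max u v) := {g : FreeGroup L × S.BoundaryPath // g.2 ∈ S.U g.1}

/-- The subspace topology of the product of the discrete free group and `∂E`. -/
instance : TopologicalSpace S.Arrow :=
  letI : TopologicalSpace (FreeGroup L) := ⊥
  (inferInstance : TopologicalSpace (FreeGroup L × S.BoundaryPath)).induced Subtype.val

variable {S}

/-- The source `φ_{t⁻¹}(μ)` of the arrow `(t, μ)`. -/
noncomputable def Arrow.source (g : S.Arrow) : S.BoundaryPath :=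
  (φ g.1.1⁻¹ ⟨g.1.2, by rw [inv_inv]; exact g.2⟩ : S.U g.1.1⁻¹).1

theorem Arrow.shift (g : S.Arrow) : Shift g.1.1 g.1.2 g.source := shift_iff.2 ⟨g.2, rfl⟩

theorem Arrow.source_eq {g : S.Arrow} {κ : S.BoundaryPath} (h : Shift g.1.1 g.1.2 κ) :
    g.source = κ := (shift_iff.1 h).2

variable (S)

/-- The transformation groupoid of the partial action. Its unit space is identified with `∂E`
through `μ ↦ (1, μ)`. -/
noncomputable def transformationGroupoid : GroupoidOn S.Arrow S.BoundaryPath where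
  r g := g.1.2
  s g := g.source
  one μ := ⟨(1, μ), Or.inl rfl⟩
  inv g := ⟨(g.1.1⁻¹, g.source), (shift_iff.1 g.shift.symm).1⟩
  mul g h hgh := ⟨(g.1.1 * h.1.1, g.1.2), by
    have h1 := g.shift
    rw [hgh] at h1
    exact (shift_iff.1 (h1.trans h.shift)).1⟩
  r_one _ := rfl
  s_one μ := Arrow.source_eq (Shift.refl μ)
  r_inv _ := rfl
  s_inv g := Arrow.source_eq g.shift.symm
  r_mul _ _ _ := rfl
  s_mul g h hgh := Arrow.source_eq (by
    have h1 := g.shift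
    rw [hgh] at h1
    exact h1.trans h.shift)
  one_mul g := Subtype.ext (Prod.ext (_root_.one_mul _) rfl)
  mul_one g := Subtype.ext (Prod.ext (_root_.mul_one _) rfl)
  inv_mul g := Subtype.ext (Prod.ext (inv_mul_cancel _) rfl)
  mul_inv g := Subtype.ext (Prod.ext (mul_inv_cancel _) rfl)
  mul_assoc g h k _ _ := Subtype.ext (Prod.ext (_root_.mul_assoc _ _ _) rfl)

end GenBooleanDynamicalSystem

end BooleanDynamics

/-! A path fixed by some `t ≠ 1` has the form `α γ γ γ ⋯`: if `t = α' β⁻¹`, then `α'` and `β` are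
prefixes of the same path, and `γ` is what the longer has beyond the shorter. Fixed paths are
therefore infinite. At an infinite path the word cylinders of its prefixes form a neighbourhood base
(`isOpen_wordCylinder`, `wordFilter_le_nhds`), so the subtracted compact sets in the topology of
`∂E` play no role there.

If the set of fixed points of `t` has interior, it contains a word cylinder whose word is `α
γ^{n+1}`. Conjugation by this word, which agrees with conjugation by `α` on powers of `γ`, yields `A
≠ ⊥` such that every path `ν` with `A ∈ r(ν)` satisfies `ν = γ ν` (`exists_forall_extends_self`).
Every vertex is the range of a boundary path, so this statement about paths becomes one about
ultrafilters, and `(γ, A)` is a cycle without exits. Conversely, a cycle `(α, A)` without exits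
forces each path whose range contains `A` to begin with every power of `α` without changing its
range. Labels and range determine the edges, so the path is fixed by `α`, on a nonempty open set.

Arrows over a fixed group element form an open slice whose isotropy is the fixed point set of that
element. Hence effectiveness is equivalent to topological freeness, and topological principality
implies both.

Topological freeness gives topological principality by a Baire category argument. A path has trivial
isotropy if no two different iterated tails agree, which is one condition for each pair of natural
numbers rather than for each group element. By freeness each condition can be achieved in every open
set containing an infinite path, and it persists on a small cylinder. A nested sequence of cylinders
meets all conditions, and compactness supplies a common point (`exists_forall_mem_wordCylinder`). -/

namespace BooleanDynamics

universe u v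

/-! ### Ultrafilters of ideals: existence, separation and limits -/

section Filters

variable {B : Type u} [GeneralizedBooleanAlgebra B] {I ξ : Set B}

/-- Every filter of `I` is contained in an ultrafilter of `I`. -/
theorem IsFilterIn.exists_le (h : IsFilterIn I ξ) : ∃ ζ, ξ ⊆ ζ ∧ IsUltrafilterIn I ζ := by
  refine zorn_subset_nonempty {ζ | IsFilterIn I ζ} ?_ ξ h
  intro c hc hch ⟨ζ₀, hζ₀⟩
  refine ⟨⋃₀ c, ⟨?_, ?_, ?_, ?_, ?_⟩, fun ζ hζ => Set.subset_sUnion_of_mem hζ⟩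
  · exact Set.sUnion_subset fun ζ hζ => (hc hζ).1
  · exact (hc hζ₀).2.1.mono (Set.subset_sUnion_of_mem hζ₀)
  · rintro ⟨ζ, hζ, hb⟩
    exact (hc hζ).2.2.1 hb
  · rintro A ⟨ζ, hζ, hA⟩ C hC hle
    exact ⟨ζ, hζ, (hc hζ).2.2.2.1 A hA C hC hle⟩
  · rintro A ⟨ζ, hζ, hA⟩ C ⟨ζ', hζ', hC⟩
    rcases hch.total hζ hζ' with hle | hle
    · obtain ⟨D, hD, h1⟩ := (hc hζ').2.2.2.2 A (hle hA) C hC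
      exact ⟨D, ⟨ζ', hζ', hD⟩, h1⟩
    · obtain ⟨D, hD, h1⟩ := (hc hζ).2.2.2.2 A hA C (hle hC)
      exact ⟨D, ⟨ζ, hζ, hD⟩, h1⟩

theorem exists_isUltrafilterIn_mem {A : B} (hA : A ∈ I) (hne : A ≠ ⊥) :
    ∃ ξ, A ∈ ξ ∧ IsUltrafilterIn I ξ := by
  have hf : IsFilterIn I {C | C ∈ I ∧ A ≤ C} := by
    refine ⟨fun C hC => hC.1, ⟨A, hA, le_rfl⟩, fun hb => hne (le_bot_iff.1 hb.2),
      fun C hC D hD hle => ⟨hD, hC.2.trans hle⟩, fun C hC D hD => ⟨A, ⟨hA, le_rfl⟩, hC.2, hD.2⟩⟩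
  obtain ⟨ζ, h1, h2⟩ := hf.exists_le
  exact ⟨ζ, h1 ⟨hA, le_rfl⟩, h2⟩

theorem exists_vertex_mem {A : B} (hne : A ≠ ⊥) : ∃ χ : Vertex B, A ∈ χ.1 := by
  obtain ⟨ξ, h1, h2⟩ := exists_isUltrafilterIn_mem (Set.mem_univ A) hne
  exact ⟨⟨ξ, h2⟩, h1⟩

theorem IsUltrafilterIn.sdiff_mem (hI : IsLowerSet I) (h : IsUltrafilterIn I ξ)
    {A C : B} (hC : C ∈ ξ) (hAI : A ∈ I) (hA : A ∉ ξ) : C \ A ∈ ξ := by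
  have hC' : C ⊓ A ⊔ C \ A ∈ ξ := by rwa [sup_comm, sup_sdiff_inf]
  rcases h.mem_or_mem hI hC' with h1 | h1
  · exact absurd (h.1.2.2.2.1 _ h1 _ hAI inf_le_right) hA
  · exact h1

theorem IsUltrafilterIn.notMem_of_disjoint (hI : IsLowerSet I) (h : IsUltrafilterIn I ξ)
    {A C : B} (hC : C ∈ ξ) (hd : A ⊓ C = ⊥) : A ∉ ξ := fun hA =>
  h.1.2.2.1 (hd ▸ h.1.inf_mem hI hA hC)

/-- Two distinct ultrafilters of `I` are separated by disjoint elements. -/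
theorem IsUltrafilterIn.exists_disjoint (hI : IsLowerSet I) {ζ : Set B}
    (h : IsUltrafilterIn I ξ) (h' : IsUltrafilterIn I ζ) (hne : ξ ≠ ζ) :
    ∃ A ∈ ξ, ∃ C ∈ ζ, A ⊓ C = ⊥ := by
  obtain ⟨A, hA, hA'⟩ : ∃ A ∈ ξ, A ∉ ζ := by
    by_contra hcon
    push Not at hcon
    exact hne (subset_antisymm hcon (h.2 h'.1 hcon))
  obtain ⟨C, hC⟩ := h'.1.2.1
  exact ⟨A, hA, C \ A, h'.sdiff_mem hI hC (h.1.1 hA) hA', inf_sdiff_self_right⟩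

/-- The limit of a family of ultrafilters of `I` along an ultrafilter on the index set. -/
theorem isUltrafilterIn_limit (hI : IsLowerSet I) {X : Type*} (𝓤 : Ultrafilter X)
    {f : X → Set B} (hf : ∀ᶠ x in 𝓤, IsUltrafilterIn I (f x)) {C : B}
    (hC : ∀ᶠ x in 𝓤, C ∈ f x) : IsUltrafilterIn I {A | ∀ᶠ x in 𝓤, A ∈ f x} := by
  refine IsFilterIn.isUltrafilterIn hI ⟨?_, ⟨C, hC⟩, ?_, ?_, ?_⟩ ?_
  · intro A hA
    obtain ⟨x, h1, h2⟩ := (hf.and hA).exists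
    exact h1.1.1 h2
  · intro hb
    obtain ⟨x, h1, h2⟩ := (hf.and hb).exists
    exact h1.1.2.2.1 h2
  · intro A hA D hD hle
    filter_upwards [hf, hA] with x h1 h2
    exact h1.1.2.2.2.1 A h2 D hD hle
  · intro A hA D hD
    refine ⟨A ⊓ D, ?_, inf_le_left, inf_le_right⟩
    filter_upwards [hf, hA, hD] with x h1 h2 h3
    exact h1.1.inf_mem hI h2 h3
  · intro A D hAD
    -- The limit is prime because an ultrafilter on the index set decides every disjunction.
    refine Ultrafilter.eventually_or.1 ?_
    filter_upwards [hf, hAD] with x h1 h2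
    exact h1.mem_or_mem hI h2

/-- The generating sets are closed under finite intersections, so the subbasis is a basis; the
induction follows the generation of the open set. -/
theorem Stone.exists_of_mem_nhds (hI : IsLowerSet I) {ξ : Stone I} {V : Set (Stone I)}
    (hV : V ∈ nhds ξ) : ∃ A ∈ ξ.1, ∀ ζ : Stone I, A ∈ ζ.1 → ζ ∈ V := by
  obtain ⟨O, hOV, hO, hξ⟩ := mem_nhds_iff.1 hV
  suffices h : ∃ A ∈ ξ.1, ∀ ζ : Stone I, A ∈ ζ.1 → ζ ∈ O by
    obtain ⟨A, hA, h⟩ := h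
    exact ⟨A, hA, fun ζ hζ => hOV (h ζ hζ)⟩
  clear hOV hV
  induction hO with
  | basic s hs =>
    obtain ⟨A, hA, rfl⟩ := hs
    exact ⟨A, hξ, fun ζ hζ => hζ⟩
  | univ =>
    obtain ⟨A, hA⟩ := ξ.2.1.2.1
    exact ⟨A, hA, fun _ _ => trivial⟩
  | inter s t _ _ ihs iht =>
    obtain ⟨A, hA, h1⟩ := ihs hξ.1
    obtain ⟨C, hC, h2⟩ := iht hξ.2
    refine ⟨A ⊓ C, ξ.2.1.inf_mem hI hA hC, fun ζ hζ => ⟨h1 ζ ?_, h2 ζ ?_⟩⟩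
    · exact ζ.2.1.2.2.2.1 _ hζ _ (ξ.2.1.1 hA) inf_le_left
    · exact ζ.2.1.2.2.2.1 _ hζ _ (ξ.2.1.1 hC) inf_le_right
  | sUnion T _ ih =>
    obtain ⟨s, hs, hξs⟩ := hξ
    obtain ⟨A, hA, h1⟩ := ih s hs hξs
    exact ⟨A, hA, fun ζ hζ => ⟨s, hs, h1 ζ hζ⟩⟩

end Filters

/-! ### The vertex space inside its one-point compactification -/

variable {B : Type u} {L : Type v} [GeneralizedBooleanAlgebra B]

theorem isOpen_setOf_mem_vertex (A : B) : IsOpen {χ : Vertex B | A ∈ χ.1} :=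
  TopologicalSpace.isOpen_generateFrom_of_mem ⟨A, Set.mem_univ _, rfl⟩

theorem isOpen_setOf_mem_vset (A : B) : IsOpen {x : OnePoint (Vertex B) | A ∈ vset x} := by
  have : {x : OnePoint (Vertex B) | A ∈ vset x} =
      OnePoint.some '' {χ : Vertex B | A ∈ χ.1} := by
    ext x
    constructor
    · intro h
      obtain ⟨χ, rfl⟩ := exists_coe_of_nonempty ⟨A, h⟩
      exact ⟨χ, h, rfl⟩
    · rintro ⟨χ, h, rfl⟩
      exact h
  rw [this, OnePoint.isOpen_image_coe]
  exact isOpen_setOf_mem_vertex A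

theorem OnePoint.exists_of_mem_nhds {χ : Vertex B} {V : Set (OnePoint (Vertex B))}
    (hV : V ∈ nhds (χ : OnePoint (Vertex B))) :
    ∃ A ∈ χ.1, ∀ x : OnePoint (Vertex B), A ∈ vset x → x ∈ V := by
  obtain ⟨A, hA, h⟩ := Stone.exists_of_mem_nhds isLowerSet_univ
    (OnePoint.continuous_coe.continuousAt.preimage_mem_nhds hV)
  refine ⟨A, hA, fun x hx => ?_⟩
  obtain ⟨ζ, rfl⟩ := exists_coe_of_nonempty ⟨A, hx⟩
  exact h ζ hx

theorem isUltrafilterIn_vset {x : OnePoint (Vertex B)} {A : B} (h : A ∈ vset x) :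
    IsUltrafilterIn Set.univ (vset x) := by
  obtain ⟨χ, rfl⟩ := exists_coe_of_nonempty ⟨A, h⟩
  exact χ.2

namespace GenBooleanDynamicalSystem

variable {S : GenBooleanDynamicalSystem B L}

/-! ### The topology of the edge space -/

theorem Edge.ext_of_filt {e e' : S.Edge} (hl : e.label = e'.label)
    (hf : e.filt.1 = e'.filt.1) : e = e' := by
  refine Edge.ext_of_d hl (Stone.ext ?_)
  change {A | ∃ C ∈ e.filt.1, C ≤ A} = {A | ∃ C ∈ e'.filt.1, C ≤ A}
  rw [hf]

theorem Edge.isOpen_setOf_mem_filt {a : L} {A : B} (hA : A ∈ S.ideal a) :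
    IsOpen {e : S.Edge | e.label = a ∧ A ∈ e.filt.1} :=
  TopologicalSpace.isOpen_generateFrom_of_mem ⟨a, A, hA, rfl⟩

theorem Edge.exists_of_mem_nhds {e : S.Edge} {V : Set S.Edge} (hV : V ∈ nhds e) :
    ∃ A ∈ e.filt.1, ∀ e' : S.Edge, e'.label = e.label → A ∈ e'.filt.1 → e' ∈ V := by
  obtain ⟨O, hOV, hO, he⟩ := mem_nhds_iff.1 hV
  suffices h : ∃ A ∈ e.filt.1, ∀ e' : S.Edge, e'.label = e.label → A ∈ e'.filt.1 → e' ∈ O by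
    obtain ⟨A, hA, h⟩ := h
    exact ⟨A, hA, fun e' h1 h2 => hOV (h e' h1 h2)⟩
  clear hOV hV
  induction hO with
  | basic s hs =>
    obtain ⟨a, A, hA, rfl⟩ := hs
    exact ⟨A, he.2, fun e' h1 h2 => ⟨h1.trans he.1, h2⟩⟩
  | univ =>
    obtain ⟨A, hA⟩ := e.filt.2.1.2.1
    exact ⟨A, hA, fun _ _ _ => trivial⟩
  | inter s t _ _ ihs iht =>
    obtain ⟨A, hA, h1⟩ := ihs he.1
    obtain ⟨C, hC, h2⟩ := iht he.2
    have hAI : A ∈ S.ideal e.label := e.filt.2.1.1 hA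
    have hCI : C ∈ S.ideal e.label := e.filt.2.1.1 hC
    refine ⟨A ⊓ C, e.filt.2.1.inf_mem (isLowerSet_ideal _) hA hC,
      fun e' hl h => ⟨h1 e' hl ?_, h2 e' hl ?_⟩⟩
    · exact e'.filt.2.1.2.2.2.1 _ h _ (hl ▸ hAI) inf_le_left
    · exact e'.filt.2.1.2.2.2.1 _ h _ (hl ▸ hCI) inf_le_right
  | sUnion T _ ih =>
    obtain ⟨s, hs, hes⟩ := he
    obtain ⟨A, hA, h1⟩ := ih s hs hes
    exact ⟨A, hA, fun e' h2 h3 => ⟨s, hs, h1 e' h2 h3⟩⟩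

theorem Edge.isOpen_setOf_label (a : L) : IsOpen {e : S.Edge | e.label = a} := by
  rw [isOpen_iff_mem_nhds]
  rintro e rfl
  obtain ⟨A, hA⟩ := e.filt.2.1.2.1
  filter_upwards [(Edge.isOpen_setOf_mem_filt (S := S) (e.filt.2.1.1 hA)).mem_nhds ⟨rfl, hA⟩]
    with e' he'
  exact he'.1

theorem Edge.isOpen_setOf_mem_d (A : B) : IsOpen {e : S.Edge | A ∈ e.d.1} := by
  rw [isOpen_iff_mem_nhds]
  rintro e ⟨C, hC, hle⟩
  filter_upwards [(Edge.isOpen_setOf_mem_filt (S := S) (e.filt.2.1.1 hC)).mem_nhds ⟨rfl, hC⟩]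
    with e' he'
  exact ⟨C, he'.2, hle⟩

/-- Used twice: compact sets of paths of a given length are closed, and two different edges can be
told apart by disjoint open conditions. -/
instance : T2Space S.Edge := by
  refine ⟨fun e e' hne => ?_⟩
  by_cases hl : e.label = e'.label
  · have hf : e.filt.1 ≠ e'.filt.1 := fun hf => hne (Edge.ext_of_filt hl hf)
    have h' : IsUltrafilterIn (S.ideal e.label : Set B) e'.filt.1 := by
      rw [hl]
      exact e'.filt.2
    obtain ⟨A, hA, C, hC, hAC⟩ := e.filt.2.exists_disjoint (isLowerSet_ideal _) h' hf
    refine ⟨_, _, Edge.isOpen_setOf_mem_filt (e.filt.2.1.1 hA),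
      Edge.isOpen_setOf_mem_filt (e'.filt.2.1.1 hC), ⟨rfl, hA⟩, ⟨rfl, hC⟩, ?_⟩
    refine Set.disjoint_left.2 fun x h1 h2 => ?_
    exact x.filt.2.notMem_of_disjoint (isLowerSet_ideal _) h2.2 hAC h1.2
  · refine ⟨_, _, Edge.isOpen_setOf_label e.label, Edge.isOpen_setOf_label e'.label, rfl, rfl, ?_⟩
    exact Set.disjoint_left.2 fun x h1 h2 => hl (h1.symm.trans h2)

/-- The sets `Z¹(a, C)` are compact. -/
theorem Edge.isCompact_setOf_mem_filt {a : L} {C : B} :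
    IsCompact {e : S.Edge | e.label = a ∧ C ∈ e.filt.1} := by
  rw [isCompact_iff_ultrafilter_le_nhds]
  intro 𝓤 h𝓤
  have h𝓤' : ∀ᶠ e : S.Edge in 𝓤, e.label = a ∧ C ∈ e.filt.1 := Filter.le_principal_iff.1 h𝓤
  -- The limit edge carries the label `a` and the limit of the ultrafilters along `𝓤`; membership of
  -- `C` keeps that limit nonempty.
  have hU : IsUltrafilterIn (S.ideal a : Set B) {A | ∀ᶠ e : S.Edge in 𝓤, A ∈ e.filt.1} := by
    refine isUltrafilterIn_limit (isLowerSet_ideal a) 𝓤 ?_ (h𝓤'.mono fun e he => he.2)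
    filter_upwards [h𝓤'] with e he
    rw [← he.1]
    exact e.filt.2
  refine ⟨⟨a, ⟨_, hU⟩⟩, ⟨rfl, h𝓤'.mono fun e he => he.2⟩, fun V hV => ?_⟩
  obtain ⟨A, hA, h⟩ := Edge.exists_of_mem_nhds hV
  filter_upwards [h𝓤', hA] with e h1 h2
  exact h e h1.1 h2

/-! ### Ranges of edges, regular vertices and existence of boundary paths -/

theorem exists_edge_of_mem_Δ {a : L} {A : B} (h : a ∈ S.Δ A) :
    ∃ e : S.Edge, e.label = a ∧ A ∈ vset e.r := by
  obtain ⟨ξ, h1, h2⟩ := exists_isUltrafilterIn_mem (S.θ_mem a A : _ ∈ (S.ideal a : Set B)) h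
  refine ⟨⟨a, ⟨ξ, h2⟩⟩, rfl, ?_⟩
  rw [Edge.vset_r]
  exact h1

/-- Together with `exists_edge_of_mem_Δ` this identifies `Δ_A` with the labels of the edges whose
range contains `A`, which links the Boolean algebra to the correspondence. -/
theorem Edge.label_mem_Δ {e : S.Edge} {A : B} (h : A ∈ vset e.r) : e.label ∈ S.Δ A := by
  rw [Edge.vset_r] at h
  intro hb
  rw [Set.mem_ofPred_eq, hb] at h
  exact e.filt.2.1.2.2.1 h

theorem Δ_mono {A C : B} (h : A ≤ C) : S.Δ A ⊆ S.Δ C := fun a ha hb =>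
  ha (le_bot_iff.1 (hb ▸ θ_mono a h))

/-- If `θ_a(C)` is nonempty for all `C ∈ χ`, then `χ` is the range of an edge with label `a`. -/
theorem exists_edge_of_forall_mem_Δ {a : L} {χ : Vertex B} (h : ∀ C ∈ χ.1, a ∈ S.Δ C) :
    ∃ e : S.Edge, e.label = a ∧ e.r = (χ : OnePoint (Vertex B)) := by
  have hf : IsFilterIn (S.ideal a : Set B) {D | D ∈ S.ideal a ∧ ∃ C ∈ χ.1, S.θ a C ≤ D} := by
    refine ⟨fun D hD => hD.1, ?_, ?_, ?_, ?_⟩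
    · obtain ⟨C, hC⟩ := χ.2.1.2.1
      exact ⟨_, S.θ_mem a C, C, hC, le_rfl⟩
    · rintro ⟨-, C, hC, hle⟩
      exact h C hC (le_bot_iff.1 hle)
    · rintro D ⟨-, C, hC, hle⟩ E hE hDE
      exact ⟨hE, C, hC, hle.trans hDE⟩
    · rintro D ⟨hD, C, hC, hle⟩ E ⟨hE, C', hC', hle'⟩
      refine ⟨S.θ a (C ⊓ C'), ⟨S.θ_mem _ _, _, χ.2.1.inf_mem isLowerSet_univ hC hC', le_rfl⟩,
        (θ_mono a inf_le_left).trans hle, (θ_mono a inf_le_right).trans hle'⟩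
  obtain ⟨ζ, h1, h2⟩ := hf.exists_le
  refine ⟨⟨a, ⟨ζ, h2⟩⟩, rfl, ?_⟩
  -- The range of the new edge contains `χ` and is an ultrafilter, so maximality of `χ` gives
  -- equality.
  have hsub : χ.1 ⊆ vset (Edge.r (S := S) ⟨a, ⟨ζ, h2⟩⟩) := by
    intro C hC
    rw [Edge.vset_r]
    exact h1 ⟨S.θ_mem a C, C, hC, le_rfl⟩
  obtain ⟨C, hC⟩ := χ.2.1.2.1
  obtain ⟨ψ, hψ⟩ := exists_coe_of_nonempty ⟨C, hsub hC⟩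
  rw [hψ] at hsub ⊢
  exact congrArg _ (Stone.ext (subset_antisymm (χ.2.2 ψ.2.1 hsub) hsub))

/-- Avoiding the closure of the sources means that nonempty elements below some member of `χ`
receive edges, that is, have nonempty `Δ`. Compactness of the preimage under `r` means finiteness of
`Δ`: the labels split the edge space into disjoint open sets, and conversely the preimage is a union
over `Δ_A` of the compact sets of edges with label `a` and `θ_a(A)` in their ultrafilter. -/
theorem exists_regular_mem_iff {χ : Vertex B} :
    (χ : OnePoint (Vertex B)) ∈ S.regSet ↔ ∃ A ∈ χ.1, S.IsRegular A := by
  constructor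
  · rintro ⟨⟨V, hV, hc⟩, hs⟩
    obtain ⟨A, hA, hAV⟩ := OnePoint.exists_of_mem_nhds hV
    rw [mem_closure_iff_nhds] at hs
    push Not at hs
    obtain ⟨V', hV', hs⟩ := hs
    obtain ⟨A', hA', hAV'⟩ := OnePoint.exists_of_mem_nhds hV'
    refine ⟨A ⊓ A', χ.2.1.inf_mem isLowerSet_univ hA hA', fun C hC hle => ⟨?_, ?_⟩⟩
    · obtain ⟨ψ, hψ⟩ := exists_vertex_mem hC
      have h1 : (ψ : OnePoint (Vertex B)) ∉ S.sourceSet := fun h1 => by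
        have : (ψ : OnePoint (Vertex B)) ∈ V' ∩ S.sourceSet :=
          ⟨hAV' _ (ψ.2.1.2.2.2.1 _ hψ _ (Set.mem_univ _) (hle.trans inf_le_right)), h1⟩
        rw [hs] at this
        exact this
      rw [sourceSet, Set.notMem_compl_iff, mem_closure_iff] at h1
      obtain ⟨_, h2, e, rfl⟩ := h1 _ (isOpen_setOf_mem_vset C) hψ
      exact ⟨_, Edge.label_mem_Δ h2⟩
    · obtain ⟨T, hT⟩ := hc.elim_finite_subcover (fun a : L => {e : S.Edge | e.label = a})
        Edge.isOpen_setOf_label fun e _ => Set.mem_iUnion.2 ⟨e.label, rfl⟩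
      refine T.finite_toSet.subset fun a ha => ?_
      obtain ⟨e, rfl, he⟩ := exists_edge_of_mem_Δ (Δ_mono (hle.trans inf_le_left) ha)
      obtain ⟨b, hb⟩ := Set.mem_iUnion.1 (hT (hAV _ he))
      obtain ⟨hb, h2⟩ := Set.mem_iUnion.1 hb
      rw [show e.label = b from h2]
      exact hb
  · rintro ⟨A, hA, hreg⟩
    have hA0 : A ≠ ⊥ := fun h => χ.2.1.2.2.1 (h ▸ hA)
    have hV := (isOpen_setOf_mem_vset A).mem_nhds (x := (χ : OnePoint (Vertex B))) hA
    refine ⟨⟨_, hV, ?_⟩, ?_⟩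
    · have : Edge.r (S := S) ⁻¹' {x | A ∈ vset x} =
          ⋃ a ∈ S.Δ A, {e : S.Edge | e.label = a ∧ S.θ a A ∈ e.filt.1} := by
        ext e
        simp only [Set.mem_preimage, Set.mem_ofPred_eq, Set.mem_iUnion]
        constructor
        · intro h
          refine ⟨_, Edge.label_mem_Δ h, rfl, ?_⟩
          rwa [Edge.vset_r] at h
        · rintro ⟨a, -, rfl, h⟩
          rwa [Edge.vset_r]
      rw [this]
      exact (hreg A hA0 le_rfl).2.isCompact_biUnion fun a _ => Edge.isCompact_setOf_mem_filt
    · rw [mem_closure_iff]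
      intro hcl
      obtain ⟨x, hx, hxs⟩ := hcl _ (isOpen_setOf_mem_vset A) hA
      obtain ⟨ψ, rfl⟩ := exists_coe_of_nonempty ⟨A, hx⟩
      refine hxs (mem_closure_iff_nhds.2 fun V hV => ?_)
      obtain ⟨C, hC, hCV⟩ := OnePoint.exists_of_mem_nhds hV
      have hAC : A ⊓ C ∈ ψ.1 := ψ.2.1.inf_mem isLowerSet_univ hx hC
      obtain ⟨a, ha⟩ := (hreg (A ⊓ C) (fun h => ψ.2.1.2.2.1 (h ▸ hAC)) inf_le_left).1
      obtain ⟨e, -, he⟩ := exists_edge_of_mem_Δ ha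
      exact ⟨_, hCV _ (BoundaryPath.vset_upper he inf_le_right), e, rfl⟩

/-- A regular vertex is the range of an edge. -/
theorem exists_edge_of_mem_regSet {χ : Vertex B} (h : (χ : OnePoint (Vertex B)) ∈ S.regSet) :
    ∃ e : S.Edge, e.r = (χ : OnePoint (Vertex B)) := by
  obtain ⟨A, hA, hreg⟩ := exists_regular_mem_iff.1 h
  by_contra hcon
  have h1 : ∀ a : L, ∃ C ∈ χ.1, a ∉ S.Δ C := by
    intro a
    by_contra ha
    push Not at ha
    obtain ⟨e, -, he⟩ := exists_edge_of_forall_mem_Δ ha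
    exact hcon ⟨e, he⟩
  choose C hC hCa using h1
  have hA0 : A ≠ ⊥ := fun h => χ.2.1.2.2.1 (h ▸ hA)
  -- Each label vanishes on some member of `χ`. Since `Δ_A` is finite, intersecting finitely many
  -- members gives `D ∈ χ` below `A` with `Δ_D` empty, against regularity.
  have key : ∀ T : Finset L, ∃ D ∈ χ.1, D ≤ A ∧ ∀ a ∈ T, a ∉ S.Δ D := by
    classical
    intro T
    induction T using Finset.induction_on with
    | empty => exact ⟨A, hA, le_rfl, by simp⟩
    | insert a T _ ih =>
      obtain ⟨D, hD, hDA, h2⟩ := ih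
      refine ⟨D ⊓ C a, χ.2.1.inf_mem isLowerSet_univ hD (hC a), inf_le_left.trans hDA, ?_⟩
      intro b hb hbΔ
      rcases Finset.mem_insert.1 hb with rfl | hb
      · exact hCa _ (Δ_mono inf_le_right hbΔ)
      · exact h2 b hb (Δ_mono inf_le_left hbΔ)
  obtain ⟨D, hD, hDA, h2⟩ := key (hreg A hA0 le_rfl).2.toFinset
  obtain ⟨a, ha⟩ := (hreg D (fun h => χ.2.1.2.2.1 (h ▸ hD)) hDA).1
  exact h2 a (by simpa using Δ_mono hDA ha) ha

/-- Every vertex is the range of a boundary path. -/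
theorem exists_boundaryPath_r_eq (χ : Vertex B) :
    ∃ ν : S.BoundaryPath, ν.r = (χ : OnePoint (Vertex B)) := by
  by_contra hχ
  -- A vertex of `X` is regular, as otherwise it would itself be a boundary path. It is thus the
  -- range of an edge, whose `d` lies again in `X`; iteration produces an infinite path starting at
  -- `χ`.
  let X := {ψ : Vertex B // ¬ ∃ ν : S.BoundaryPath, ν.r = (ψ : OnePoint (Vertex B))}
  have hstep : ∀ ψ : X, ∃ (e : S.Edge) (ψ' : X), e.r = (ψ.1 : OnePoint (Vertex B)) ∧
      e.d = ψ'.1 := by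
    rintro ⟨ψ, hψ⟩
    have hreg : (ψ : OnePoint (Vertex B)) ∈ S.regSet := by
      by_contra hs
      exact hψ ⟨Sum.inr ⟨Sum.inl ψ, hs⟩, rfl⟩
    obtain ⟨e, he⟩ := exists_edge_of_mem_regSet hreg
    refine ⟨e, ⟨e.d, ?_⟩, he, rfl⟩
    rintro ⟨ν, hν⟩
    exact hψ ⟨BoundaryPath.cons e ν hν.symm, (BoundaryPath.r_cons _ _ _).trans he⟩
  choose E f hr hd using hstep
  refine hχ ⟨Sum.inl ⟨fun i => E (f^[i] ⟨χ, hχ⟩), fun i => ?_⟩, hr ⟨χ, hχ⟩⟩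
  rw [hd, hr, Function.iterate_succ_apply']

/-! ### Open cylinders in the boundary path space -/

theorem isOpen_cylinder {X : Set S.FinPath} (hX : IsOpen X) : IsOpen (cylinder X) := by
  refine TopologicalSpace.isOpen_generateFrom_of_mem ⟨X, ∅, hX, isCompact_empty, ?_⟩
  have : cylinder (∅ : Set S.FinPath) = ∅ := by
    ext μ
    simp [cylinder]
  rw [this, Set.compl_empty, Set.inter_univ]

namespace BoundaryPath

theorem d_eq_r_of_edge {μ : S.BoundaryPath} {i : ℕ} {e e' : S.Edge} (h : μ.edge i = some e)
    (h' : μ.edge (i + 1) = some e') : (e.d : OnePoint (Vertex B)) = e'.r := by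
  rcases μ with p | ⟨χ | ⟨n, p⟩, hp⟩
  · simp only [edge, Option.some.injEq] at h h'
    subst h h'
    exact p.2 i
  · simp [edge] at h
  · simp only [edge] at h h'
    split_ifs at h h' with h1 h2
    simp only [Option.some.injEq] at h h'
    subst h h'
    exact p.2 ⟨i, by omega⟩

theorem r_eq_of_edge {μ : S.BoundaryPath} {e : S.Edge} (h : μ.edge 0 = some e) : μ.r = e.r := by
  obtain ⟨hr, hμ⟩ := exists_eq_cons h
  rw [hμ, r_cons]

theorem edge_iterate_tail (μ : S.BoundaryPath) (k i : ℕ) :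
    (tail^[k] μ).edge i = μ.edge (k + i) := by
  induction k generalizing μ with
  | zero => simp
  | succ k ih =>
    rw [Function.iterate_succ_apply, ih, edge_tail]
    congr 1
    omega

/-- The boundary paths `w ν` for which `A ∈ r(ν)`. -/
def wordCylinder (w : List L) (A : B) : Set S.BoundaryPath :=
  {μ | ∃ ν, Extends w ν μ ∧ A ∈ vset ν.r}

theorem mem_wordCylinder_nil {A : B} {μ : S.BoundaryPath} :
    μ ∈ wordCylinder [] A ↔ A ∈ vset μ.r := by
  constructor
  · rintro ⟨ν, h, hA⟩
    rwa [extends_nil.1 h]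
  · exact fun h => ⟨μ, extends_nil.2 rfl, h⟩

theorem wordCylinder_append_subset {w γ : List L} {A C : B} (h : C ≤ S.θw γ A) :
    wordCylinder (w ++ γ) C ⊆ (wordCylinder w A : Set S.BoundaryPath) := by
  rintro μ ⟨ν, hν, hC⟩
  obtain ⟨κ, h1, h2⟩ := extends_append.1 hν
  refine ⟨κ, h1, ?_⟩
  rw [h2.vset_r]
  exact vset_upper hC h

theorem wordCylinder_mono {w : List L} {A C : B} (h : C ≤ A) :
    wordCylinder w C ⊆ (wordCylinder w A : Set S.BoundaryPath) :=
  fun _ ⟨ν, hν, hC⟩ => ⟨ν, hν, vset_upper hC h⟩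

/-- It is the cylinder of an open set of finite paths: the vertices containing `A` if `w` is empty,
and otherwise the paths with labels `w` whose `d` contains `A`. -/
theorem isOpen_wordCylinder (w : List L) (A : B) :
    IsOpen (wordCylinder w A : Set S.BoundaryPath) := by
  rcases hw : w.length with _ | n
  · obtain rfl := List.length_eq_zero_iff.1 hw
    have : (wordCylinder [] A : Set S.BoundaryPath) =
        cylinder (Sum.inl '' {χ : Vertex B | A ∈ χ.1}) := by
      ext μ
      rw [mem_wordCylinder_nil]
      constructor
      · intro h
        obtain ⟨χ, hχ⟩ := exists_coe_of_nonempty ⟨A, h⟩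
        refine Or.inl ⟨χ, hχ, χ, ?_, rfl⟩
        rw [hχ] at h
        exact h
      · rintro (⟨χ, hχ, ψ, hψ, he⟩ | ⟨n, p, ⟨ψ, hψ, he⟩, -⟩)
        · obtain rfl := Sum.inl_injective he
          rw [hχ]
          exact hψ
        · cases he
    rw [this]
    exact isOpen_cylinder (isOpenMap_inl _ (isOpen_setOf_mem_vertex A))
  · let X : Set (S.PosPath n) := {p | (∀ i : Fin (n + 1), (p.1 i).label = w[(i : ℕ)]) ∧
      A ∈ (p.1 (Fin.last n)).d.1}
    have hc : ∀ i : Fin (n + 1), Continuous fun p : S.PosPath n => p.1 i :=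
      fun i => (continuous_apply i).comp continuous_subtype_val
    have hX : IsOpen X := by
      have : X = (⋂ i : Fin (n + 1), (fun p : S.PosPath n => p.1 i) ⁻¹'
          {e | e.label = w[(i : ℕ)]}) ∩
          (fun p : S.PosPath n => p.1 (Fin.last n)) ⁻¹' {e | A ∈ e.d.1} := by
        ext p
        simp [X]
      rw [this]
      exact (isOpen_iInter_of_finite fun i => (Edge.isOpen_setOf_label _).preimage (hc i)).inter
        ((Edge.isOpen_setOf_mem_d (S := S) A).preimage (hc _))
    have : (wordCylinder w A : Set S.BoundaryPath) = cylinder (Sum.inr '' (Sigma.mk n '' X)) := by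
      ext μ
      constructor
      · rintro ⟨ν, ⟨h1, rfl⟩, hA⟩
        have h2 : ∀ i : Fin (n + 1), ∃ e, μ.edge i = some e ∧ e.label = w[(i : ℕ)] :=
          fun i => h1 i (by omega)
        choose p hp hl using h2
        refine Or.inr ⟨n, ⟨p, fun i => d_eq_r_of_edge (hp i.castSucc) (hp i.succ)⟩,
          ⟨_, ⟨_, ⟨hl, ?_⟩, rfl⟩, rfl⟩, hp⟩
        have hlast : μ.edge n = some (p (Fin.last n)) := hp (Fin.last n)
        rw [hw, vset_r_tail_of_edge hlast] at hA
        exact hA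
      · rintro (⟨χ, hχ, ψ, hψ, he⟩ | ⟨m, p, ⟨_, ⟨q, hq, rfl⟩, he⟩, hp⟩)
        · cases he
        · cases he
          refine ⟨_, ⟨fun i hi => ⟨_, hp ⟨i, by omega⟩, hq.1 ⟨i, by omega⟩⟩, rfl⟩, ?_⟩
          have hlast : μ.edge n = some (q.1 (Fin.last n)) := hp (Fin.last n)
          rw [hw, vset_r_tail_of_edge hlast]
          exact hq.2
    rw [this]
    exact isOpen_cylinder (isOpenMap_inr _ (isOpenMap_sigmaMk _ hX))

/-! ### Neighbourhoods of infinite paths -/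

theorem exists_extends_inl (p : S.InfPath) (n : ℕ) :
    ∃ (w : List L) (ν : S.BoundaryPath), w.length = n ∧ Extends w ν (Sum.inl p) :=
  ⟨List.ofFn fun i : Fin n => (p.1 i).label, _, by simp,
    fun i hi => ⟨p.1 i, rfl, by simp⟩, rfl⟩

theorem vset_r_nonempty_of_extends_inl {p : S.InfPath} {w : List L} {ν : S.BoundaryPath}
    (hw : w ≠ []) (h : Extends w ν (Sum.inl p)) : (vset ν.r).Nonempty :=
  (h.nonempty hw).mono Set.inter_subset_left

/-- A word cylinder around an infinite path contains a cylinder around that path for every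
prefix that is at least as long. -/
theorem exists_wordCylinder_subset {p : S.InfPath} {w w' : List L} {ν ν' : S.BoundaryPath}
    {A : B} (h : Extends w ν (Sum.inl p)) (hA : A ∈ vset ν.r) (h' : Extends w' ν' (Sum.inl p))
    (hle : w.length ≤ w'.length) :
    ∃ C ∈ vset ν'.r, (wordCylinder w' C : Set S.BoundaryPath) ⊆ wordCylinder w A := by
  obtain ⟨γ, rfl, hγ⟩ := h.split h' hle
  refine ⟨S.θw γ A, ?_, wordCylinder_append_subset le_rfl⟩
  rw [hγ.vset_r] at hA
  exact hA

/-- The filter generated by the word cylinders that contain an infinite path. -/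
def wordFilter (p : S.InfPath) : Filter S.BoundaryPath where
  sets := {T | ∃ (w : List L) (ν : S.BoundaryPath) (A : B), Extends w ν (Sum.inl p) ∧
    A ∈ vset ν.r ∧ wordCylinder w A ⊆ T}
  univ_sets := by
    -- The empty prefix would not do, since the range of `p` may be the point at infinity and then
    -- contains no `A`.
    obtain ⟨w, ν, hw, h⟩ := exists_extends_inl p 1
    obtain ⟨A, hA⟩ := vset_r_nonempty_of_extends_inl (by rintro rfl; simp at hw) h
    exact ⟨w, ν, A, h, hA, Set.subset_univ _⟩
  sets_of_superset := by
    rintro T T' ⟨w, ν, A, h, hA, hT⟩ hTT'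
    exact ⟨w, ν, A, h, hA, hT.trans hTT'⟩
  inter_sets := by
    rintro T T' ⟨w, ν, A, h, hA, hT⟩ ⟨w', ν', A', h', hA', hT'⟩
    rcases le_total w.length w'.length with hle | hle
    · obtain ⟨C, hC, hsub⟩ := exists_wordCylinder_subset h hA h' hle
      exact ⟨w', ν', C ⊓ A', h', vset_inf hC hA', Set.subset_inter
        (((wordCylinder_mono inf_le_left).trans hsub).trans hT)
        ((wordCylinder_mono inf_le_right).trans hT')⟩
    · obtain ⟨C, hC, hsub⟩ := exists_wordCylinder_subset h' hA' h hle
      exact ⟨w, ν, A ⊓ C, h, vset_inf hA hC, Set.subset_inter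
        ((wordCylinder_mono inf_le_left).trans hT)
        (((wordCylinder_mono inf_le_right).trans hsub).trans hT')⟩

theorem wordCylinder_mem_wordFilter {p : S.InfPath} {w : List L} {A : B}
    (h : Sum.inl p ∈ (wordCylinder w A : Set S.BoundaryPath)) :
    wordCylinder w A ∈ wordFilter p := by
  obtain ⟨ν, h, hA⟩ := h
  exact ⟨w, ν, A, h, hA, subset_rfl⟩

/-- Allowing every sufficiently long prefix leaves its choice open, for instance a prefix consisting
of complete periods. -/
theorem exists_wordCylinder_of_mem_wordFilter {p : S.InfPath} {T : Set S.BoundaryPath}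
    (hT : T ∈ wordFilter p) :
    ∃ n : ℕ, ∀ (w : List L) (ν : S.BoundaryPath), n ≤ w.length → Extends w ν (Sum.inl p) →
      ∃ A ∈ vset ν.r, wordCylinder w A ⊆ T := by
  obtain ⟨w, ν, A, h, hA, hT⟩ := hT
  refine ⟨w.length, fun w' ν' hle h' => ?_⟩
  obtain ⟨C, hC, hsub⟩ := exists_wordCylinder_subset h hA h' hle
  exact ⟨C, hC, hsub.trans hT⟩

/-- A prefix of length `i + 1` fixes the label of the edge with index `i`, and the element `A` at
its end controls the ultrafilter of that edge, because `A` lies in the ideal of the label. -/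
theorem eventually_edge_mem {p : S.InfPath} {i : ℕ} {O : Set S.Edge} (hO : O ∈ nhds (p.1 i)) :
    ∀ᶠ κ in wordFilter p, ∃ e ∈ O, κ.edge i = some e := by
  obtain ⟨A, hA, h⟩ := Edge.exists_of_mem_nhds hO
  obtain ⟨w, ν, hw, hν⟩ := exists_extends_inl p (i + 1)
  have hedge : edge (Sum.inl p) i = some (p.1 i) := rfl
  have hν2 := hν.2
  rw [hw] at hν2
  have hAν : A ∈ vset ν.r := by
    rw [← hν2, vset_r_tail_of_edge hedge]
    exact ⟨A, hA, le_rfl⟩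
  refine ⟨w, ν, A, hν, hAν, ?_⟩
  rintro κ ⟨ν', ⟨h1, rfl⟩, hA'⟩
  obtain ⟨e, he, hl⟩ := h1 i (by omega)
  obtain ⟨e', he', hl'⟩ := hν.1 i (by omega)
  rw [hedge, Option.some.injEq] at he'
  subst he'
  refine ⟨e, h e (hl.trans hl'.symm) ?_, he⟩
  rw [hw, vset_r_tail_of_edge he] at hA'
  rw [e.filt_eq]
  refine ⟨hA', ?_⟩
  rw [hl, ← hl']
  exact (p.1 i).filt.2.1.1 hA

theorem eventually_mem_r {p : S.InfPath} {D : B} (h : D ∈ vset (r (Sum.inl p))) :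
    ∀ᶠ κ in wordFilter p, D ∈ vset κ.r :=
  ⟨[], _, D, extends_nil.2 rfl, h, fun _ hκ => mem_wordCylinder_nil.1 hκ⟩

/-- The range may be the point at infinity, so it need not contain an element disjoint from `D`. The
witness is found one step later, as a member of the ultrafilter of the first edge disjoint from the
image of `D`. -/
theorem eventually_notMem_r {p : S.InfPath} {D : B} (h : D ∉ vset (r (Sum.inl p))) :
    ∀ᶠ κ in wordFilter p, D ∉ vset κ.r := by
  have h' : S.θ (p.1 0).label D ∉ (p.1 0).filt.1 := by
    change D ∉ vset (p.1 0).r at h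
    rwa [Edge.vset_r] at h
  obtain ⟨C, hC⟩ := (p.1 0).filt.2.1.2.1
  have hd := (p.1 0).filt.2.sdiff_mem (isLowerSet_ideal _) hC (S.θ_mem _ _) h'
  filter_upwards [eventually_edge_mem ((Edge.isOpen_setOf_mem_filt
    ((p.1 0).filt.2.1.1 hd)).mem_nhds ⟨rfl, hd⟩)]
  rintro κ ⟨e, ⟨hl, he⟩, hκ⟩
  rw [r_eq_of_edge hκ, Edge.vset_r]
  refine e.filt.2.notMem_of_disjoint (isLowerSet_ideal _) he ?_
  rw [hl, inf_sdiff_self_right]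

theorem eventually_segment_mem {p : S.InfPath} {n : ℕ} {O : Set (S.PosPath n)} (hO : IsOpen O)
    {q : S.PosPath n} (hq : q ∈ O) (hpq : ∀ i : Fin (n + 1), p.1 i = q.1 i) :
    ∀ᶠ κ in wordFilter p, ∃ q ∈ O, ∀ i : Fin (n + 1), κ.edge i = some (q.1 i) := by
  obtain ⟨O', hO', rfl⟩ := isOpen_induced_iff.1 hO
  obtain ⟨I, V, hV, hsub⟩ := isOpen_pi_iff.1 hO' q.1 hq
  -- Coordinates outside `I` are unconstrained, but the corresponding edges still have to exist.
  have h1 : ∀ i : Fin (n + 1), ∀ᶠ κ in wordFilter p, ∃ e : S.Edge, (i ∈ I → e ∈ V i) ∧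
      κ.edge i = some e := by
    intro i
    by_cases hi : i ∈ I
    · filter_upwards [eventually_edge_mem (p := p) (i := i) (O := V i)
        (by rw [hpq]; exact (hV i hi).1.mem_nhds (hV i hi).2)]
      rintro κ ⟨e, he, hκ⟩
      exact ⟨e, fun _ => he, hκ⟩
    · filter_upwards [eventually_edge_mem (p := p) (i := i) Filter.univ_mem]
      rintro κ ⟨e, -, hκ⟩
      exact ⟨e, fun h => absurd h hi, hκ⟩
  filter_upwards [Filter.eventually_all.2 h1] with κ hκ
  choose f hf hκ using hκ
  exact ⟨⟨f, fun i => d_eq_r_of_edge (hκ i.castSucc) (hκ i.succ)⟩,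
    hsub fun i hi => hf i hi, hκ⟩

theorem cylinder_mem_wordFilter {p : S.InfPath} {X : Set S.FinPath} (hX : IsOpen X)
    (h : Sum.inl p ∈ cylinder X) : cylinder X ∈ wordFilter p := by
  rcases h with ⟨χ, hχ, hχX⟩ | ⟨n, q, hqX, hq⟩
  · obtain ⟨A, hA, hAX⟩ := Stone.exists_of_mem_nhds isLowerSet_univ
      ((hX.preimage continuous_inl).mem_nhds hχX)
    filter_upwards [eventually_mem_r (p := p) (D := A) (by rw [hχ]; exact hA)] with κ hκ
    obtain ⟨ψ, hψ⟩ := exists_coe_of_nonempty ⟨A, hκ⟩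
    rw [hψ] at hκ
    exact Or.inl ⟨ψ, hψ, hAX ψ hκ⟩
  · filter_upwards [eventually_segment_mem
      (hX.preimage (continuous_inr.comp (continuous_sigmaMk (i := n)))) hqX
      fun i => Option.some.inj (hq i)]
    rintro κ ⟨q', hq', h⟩
    exact Or.inr ⟨n, q', hq', h⟩

/-- By maximality each `χ ∈ K` has a member outside the range of `p`; compactness reduces these to
finitely many, and their absence persists near `p`. -/
theorem eventually_r_notMem {p : S.InfPath} {K : Set (Vertex B)} (hK : IsCompact K)
    (h : ∀ χ ∈ K, r (Sum.inl p) ≠ (χ : OnePoint (Vertex B))) :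
    ∀ᶠ κ in wordFilter p, ∀ χ ∈ K, κ.r ≠ (χ : OnePoint (Vertex B)) := by
  have h1 : ∀ χ ∈ K, ∃ D ∈ χ.1, D ∉ vset (r (Sum.inl p)) := by
    intro χ hχ
    by_contra hcon
    push Not at hcon
    obtain ⟨C, hC⟩ := χ.2.1.2.1
    obtain ⟨ψ, hψ⟩ := exists_coe_of_nonempty ⟨C, hcon C hC⟩
    rw [hψ] at hcon
    refine h χ hχ (hψ.trans (congrArg _ (Stone.ext ?_)))
    exact subset_antisymm (χ.2.2 ψ.2.1 hcon) hcon
  choose! D hD hDp using h1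
  obtain ⟨T, hTK, hT⟩ := hK.elim_nhds_subcover (fun χ => {ψ : Vertex B | D χ ∈ ψ.1})
    fun χ hχ => (isOpen_setOf_mem_vertex _).mem_nhds (hD χ hχ)
  filter_upwards [(Filter.eventually_all_finset T).2 fun χ hχ =>
    eventually_notMem_r (hDp χ (hTK χ hχ))] with κ hκ χ hχ he
  obtain ⟨ψ, hψ, hχψ⟩ := Set.mem_iUnion₂.1 (hT hχ)
  refine hκ ψ hψ ?_
  rw [he]
  exact hχψ

/-- A compact set of finite paths involves finitely many lengths, and its part of each length is
compact, hence closed. The prefix of `p` of that length then has a neighbourhood missing it. -/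
theorem compl_cylinder_mem_wordFilter {p : S.InfPath} {K : Set S.FinPath} (hK : IsCompact K)
    (h : Sum.inl p ∉ cylinder K) : (cylinder K)ᶜ ∈ wordFilter p := by
  -- Vertices and single edges both receive the value `0`; only the finiteness of the image of `K`
  -- matters.
  let len : S.FinPath → ℕ := Sum.elim (fun _ => 0) fun x => x.1
  have hlen : Continuous len := continuous_const.sumElim
    (continuous_sigma fun n => continuous_const)
  have hfin : (len '' K).Finite := (hK.image hlen).finite_of_discrete
  have h0 : IsCompact ((Sum.inl : Vertex B → S.FinPath) ⁻¹' K) :=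
    Topology.IsClosedEmbedding.inl.isCompact_preimage hK
  have hn : ∀ n : ℕ, ∀ᶠ κ in wordFilter p, ¬ ∃ q : S.PosPath n, Sum.inr ⟨n, q⟩ ∈ K ∧
      ∀ i : Fin (n + 1), κ.edge i = some (q.1 i) := by
    intro n
    have hc : IsCompact ((Sum.inr ∘ Sigma.mk n : S.PosPath n → S.FinPath) ⁻¹' K) :=
      (Topology.IsClosedEmbedding.inr.comp
        Topology.IsClosedEmbedding.sigmaMk).isCompact_preimage hK
    let q : S.PosPath n := ⟨fun i => p.1 i, fun i => p.2 i⟩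
    have hq : q ∈ ((Sum.inr ∘ Sigma.mk n : S.PosPath n → S.FinPath) ⁻¹' K)ᶜ :=
      fun hq => h (Or.inr ⟨n, q, hq, fun i => rfl⟩)
    filter_upwards [eventually_segment_mem hc.isClosed.isOpen_compl hq fun i => rfl]
    rintro κ ⟨q', hq', hκ⟩ ⟨q'', hq'', hκ'⟩
    obtain rfl : q' = q'' := Subtype.ext (funext fun i =>
      Option.some.inj ((hκ i).symm.trans (hκ' i)))
    exact hq' hq''
  have h1 := eventually_r_notMem (p := p) h0 fun χ hχ he => h (Or.inl ⟨χ, he, hχ⟩)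
  filter_upwards [h1, (Filter.eventually_all_finite hfin).2 fun n _ => hn n] with κ h2 h3
  rintro (⟨χ, hχ, hχK⟩ | ⟨n, q, hqK, hq⟩)
  · exact h2 χ hχK hχ
  · exact h3 n ⟨_, hqK, rfl⟩ ⟨q, hqK, hq⟩

/-- This makes the word cylinders a neighbourhood base at infinite paths. It fails in general at
finite paths, where compact sets have to be removed. -/
theorem wordFilter_le_nhds (p : S.InfPath) : 
    wordFilter p ≤ nhds (X := S.BoundaryPath) (Sum.inl p) := by
  refine le_trans (le_iInf₂ ?_) (le_of_eq TopologicalSpace.nhds_generateFrom.symm)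
  rintro _ ⟨hp, U, K, hU, hK, rfl⟩
  rw [Filter.le_principal_iff]
  exact Filter.inter_mem (cylinder_mem_wordFilter hU hp.1)
    (compl_cylinder_mem_wordFilter hK hp.2)

end BoundaryPath

/-! ### Fixed points of the partial action -/

theorem mem_fixedPoints_iff {t : FreeGroup L} {μ : S.BoundaryPath} :
    μ ∈ S.fixedPoints t ↔ Shift t μ μ := by
  constructor
  · rintro ⟨h, hm⟩
    have h1 := shift_move h
    rwa [show move t μ = μ from hm] at h1
  · intro h
    obtain ⟨h1, h2⟩ := shift_iff.1 h.symm
    rw [inv_inv] at h2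
    exact ⟨h1, h2⟩

theorem isReducedPair_nil_right (α : List L) : IsReducedPair α [] := by
  simp [IsReducedPair]

theorem wordElt_ne_one {α : List L} (h : α ≠ []) : wordElt α ≠ 1 := fun he =>
  h ((isReducedPair_nil_right α).unique (isReducedPair_nil_right []) (by simpa [wordElt] using he)).1

namespace BoundaryPath

theorem exists_eq_inl_iff {μ : S.BoundaryPath} :
    (∃ p, μ = Sum.inl p) ↔ ∀ i, ∃ e, μ.edge i = some e := by
  constructor
  · rintro ⟨p, rfl⟩ i
    exact ⟨_, rfl⟩
  · intro h
    rcases μ with p | ⟨χ | ⟨n, p⟩, hp⟩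
    · exact ⟨p, rfl⟩
    · obtain ⟨e, he⟩ := h 0
      simp [edge] at he
    · obtain ⟨e, he⟩ := h (n + 1)
      simp [edge] at he

theorem Extends.edge_add {w : List L} {ν μ : S.BoundaryPath} (h : Extends w ν μ) (i : ℕ) :
    μ.edge (w.length + i) = ν.edge i := by
  rw [← edge_iterate_tail, h.2]

/-- Shifting indices by `|γ|` carries the edges provided by `γ` to all positions. -/
theorem Extends.exists_eq_inl_of_self {γ : List L} {ν : S.BoundaryPath} (h : Extends γ ν ν)
    (hγ : γ ≠ []) : ∃ p, ν = Sum.inl p := by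
  rw [exists_eq_inl_iff]
  intro i
  have hpos := List.length_pos_iff.2 hγ
  induction i using Nat.strong_induction_on with
  | _ i ih =>
    by_cases hi : i < γ.length
    · obtain ⟨e, he, -⟩ := h.1 i hi
      exact ⟨e, he⟩
    · obtain ⟨e, he⟩ := ih (i - γ.length) (by omega)
      have h1 := h.edge_add (i - γ.length)
      rw [Nat.add_sub_cancel' (not_lt.1 hi)] at h1
      exact ⟨e, h1.trans he⟩

theorem Extends.exists_eq_inl {w : List L} {ν μ : S.BoundaryPath} (h : Extends w ν μ)
    (hν : ∃ p, ν = Sum.inl p) : ∃ p, μ = Sum.inl p := by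
  rw [exists_eq_inl_iff] at hν ⊢
  intro i
  by_cases hi : i < w.length
  · obtain ⟨e, he, -⟩ := h.1 i hi
    exact ⟨e, he⟩
  · obtain ⟨e, he⟩ := hν (i - w.length)
    have h1 := h.edge_add (i - w.length)
    rw [Nat.add_sub_cancel' (not_lt.1 hi)] at h1
    exact ⟨e, h1.trans he⟩

/-- The hypothesis demands an edge at every index, so both paths are infinite. Edges alone do not
determine a path of length `0`. -/
theorem eq_of_edge_eq {μ κ : S.BoundaryPath}
    (h : ∀ i, ∃ e, μ.edge i = some e ∧ κ.edge i = some e) : μ = κ := by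
  obtain ⟨p, rfl⟩ := exists_eq_inl_iff.2 fun i => (h i).imp fun _ he => he.1
  obtain ⟨q, rfl⟩ := exists_eq_inl_iff.2 fun i => (h i).imp fun _ he => he.2
  refine congrArg Sum.inl (Subtype.ext (funext fun i => ?_))
  obtain ⟨e, h1, h2⟩ := h i
  exact Option.some.inj (h1.trans h2.symm)

/-- The edges of `w ν` that come from `w` depend only on `w` and on the range of `ν`. -/
theorem Extends.edge_eq {w : List L} {ν μ ν' μ' : S.BoundaryPath} (h : Extends w ν μ)
    (h' : Extends w ν' μ') (hr : vset ν.r = vset ν'.r) {i : ℕ} (hi : i < w.length) :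
    μ.edge i = μ'.edge i := by
  induction w generalizing μ μ' i with
  | nil => simp at hi
  | cons a w ih =>
    obtain ⟨e, κ, hd, rfl, hl, h1⟩ := extends_cons.1 h
    obtain ⟨e', κ', hd', rfl, hl', h1'⟩ := extends_cons.1 h'
    -- An edge is determined by its label and its `d`, and `d` is the range of the remaining path,
    -- computed from the range of `ν` through `θ_w`.
    have hee : e = e' := by
      refine Edge.ext_of_d (hl.trans hl'.symm) (OnePoint.coe_injective ?_)
      rw [hd, hd']
      refine vset_injective ?_
      rw [h1.vset_r, h1'.vset_r, hr]
    subst hee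
    cases i with
    | zero => rw [edge_cons_zero, edge_cons_zero]
    | succ i =>
      rw [← edge_tail, ← edge_tail, tail_cons, tail_cons]
      exact ih h1 h1' (by simpa using hi)

end BoundaryPath

open BoundaryPath

/-- After cancellation of common suffixes, uniqueness of the reduced form leaves exactly the words
`γ` and `[]`. -/
theorem shift_wordElt_iff {γ : List L} {μ ν : S.BoundaryPath} :
    Shift (wordElt γ) μ ν ↔ Extends γ ν μ := by
  constructor
  · rintro ⟨α, β, κ, he, h1, h2⟩
    obtain ⟨α', β', κ', hr, he', h3, h4⟩ := exists_reduced rfl h1 h2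
    obtain ⟨rfl, rfl⟩ := hr.unique (isReducedPair_nil_right γ)
      (by rw [← he', ← he]; simp [wordElt])
    rwa [extends_nil.1 h4]
  · intro h
    exact ⟨γ, [], ν, by simp [wordElt], h, extends_nil.2 rfl⟩

/-- The arrow from `ν` to `μ` given by `α` conjugates the isotropy at `ν` into that at `μ`. -/
theorem Shift.conj {α γ : List L} {μ ν : S.BoundaryPath} (h : Extends α ν μ) :
    Shift (wordElt α * wordElt γ * (wordElt α)⁻¹) μ μ ↔ Extends γ ν ν := by
  rw [← shift_wordElt_iff (γ := γ)]
  have h1 := shift_wordElt_iff.2 h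
  constructor
  · intro h2
    have h3 := (h1.symm.trans h2).trans h1
    rwa [show (wordElt α)⁻¹ * (wordElt α * wordElt γ * (wordElt α)⁻¹) * wordElt α = wordElt γ by
      group] at h3
  · intro h2
    exact (h1.trans h2).trans h1.symm

/-- A boundary path that is fixed by a nontrivial element is of the form `α γ γ γ ⋯`. -/
theorem Shift.exists_periodic {t : FreeGroup L} (ht : t ≠ 1) {μ : S.BoundaryPath}
    (h : Shift t μ μ) : ∃ (α γ : List L) (ν : S.BoundaryPath), γ ≠ [] ∧
      (t = wordElt α * wordElt γ * (wordElt α)⁻¹ ∨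
        t⁻¹ = wordElt α * wordElt γ * (wordElt α)⁻¹) ∧
      Extends α ν μ ∧ Extends γ ν ν := by
  -- Both words are prefixes of `μ`, so the longer one is the shorter one followed by `γ`, and `γ`
  -- is nonempty because `s ≠ 1`. If `β` is the longer word this is applied to `t⁻¹`.
  have key : ∀ {s : FreeGroup L} {α β : List L} {ν : S.BoundaryPath}, s ≠ 1 →
      s = wordElt α * (wordElt β)⁻¹ → Extends α ν μ → Extends β ν μ → β.length ≤ α.length →
      ∃ (α γ : List L) (ν : S.BoundaryPath), γ ≠ [] ∧
        s = wordElt α * wordElt γ * (wordElt α)⁻¹ ∧ Extends α ν μ ∧ Extends γ ν ν := by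
    rintro s α β ν hs rfl h1 h2 hle
    obtain ⟨γ, rfl, hγ⟩ := h2.split h1 hle
    refine ⟨β, γ, ν, ?_, ?_, h2, hγ⟩
    · rintro rfl
      exact hs (by simp)
    · rw [wordElt_append]
  obtain ⟨α, β, ν, he, h1, h2⟩ := h
  rcases le_total β.length α.length with hle | hle
  · obtain ⟨α', γ, ν', h3, h4, h5⟩ := key ht he h1 h2 hle
    exact ⟨α', γ, ν', h3, Or.inl h4, h5⟩
  · obtain ⟨α', γ, ν', h3, h4, h5⟩ := key (inv_ne_one.2 ht) (by rw [he]; simp) h2 h1 hle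
    exact ⟨α', γ, ν', h3, Or.inr h4, h5⟩

/-- In `α γ γ ⋯` the tails after `|α|` and `|α| + |γ|` edges agree. Triviality of the isotropy thus
follows from conditions indexed by pairs of natural numbers. -/
theorem not_shift_of_forall_iterate_tail_ne {μ : S.BoundaryPath}
    (h : ∀ m n : ℕ, tail^[n + 1 + m] μ ≠ tail^[m] μ) {t : FreeGroup L} (ht : t ≠ 1) :
    ¬ Shift t μ μ := by
  intro hs
  obtain ⟨α, γ, ν, hγ, -, h1, h2⟩ := hs.exists_periodic ht
  obtain ⟨n, hn⟩ := Nat.exists_eq_succ_of_ne_zero (List.length_pos_iff.2 hγ).ne'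
  refine h α.length n ?_
  rw [Function.iterate_add_apply, h1.2, ← Nat.succ_eq_add_one, ← hn, h2.2]

/-! ### Condition (L) implies topological freeness -/

theorem θw_mem_wordIdeal (w : List L) (A : B) : S.θw w A ∈ S.wordIdeal w := by
  cases w with
  | nil => exact Set.mem_univ _
  | cons a w => exact ⟨_, S.θ_mem a A, le_rfl⟩

theorem BoundaryPath.Extends.flatten_replicate {γ : List L} {ν : S.BoundaryPath} (h : Extends γ ν ν) (k : ℕ) :
    Extends (List.replicate k γ).flatten ν ν := by
  induction k with
  | zero => exact extends_nil.2 rfl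
  | succ k ih =>
    rw [List.replicate_succ, List.flatten_cons]
    exact extends_append.2 ⟨ν, h, ih⟩

theorem wordElt_flatten_replicate (γ : List L) (k : ℕ) :
    wordElt (List.replicate k γ).flatten = wordElt γ ^ k := by
  induction k with
  | zero => rfl
  | succ k ih => rw [List.replicate_succ, List.flatten_cons, wordElt_append, ih, pow_succ']

/-- Near `α γ γ ⋯` there is a word cylinder inside `W` with word `w = α γ^{n+1}`. Since `γ` commutes
with its powers, `w γ w⁻¹ = α γ α⁻¹`, so an element fixing `w κ` translates into `κ = γ κ`. -/
theorem exists_forall_extends_self {t : FreeGroup L} (ht : t ≠ 1) {W : Set S.BoundaryPath}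
    (hW : IsOpen W) (hne : W.Nonempty) (hfix : ∀ μ ∈ W, Shift t μ μ) :
    ∃ (γ : List L) (A : B), γ ≠ [] ∧ A ≠ ⊥ ∧
      ∀ ν : S.BoundaryPath, A ∈ vset ν.r → Extends γ ν ν := by
  obtain ⟨μ, hμ⟩ := hne
  obtain ⟨α, γ, ν, hγ, hs, h1, h2⟩ := (hfix μ hμ).exists_periodic ht
  have hfix' : ∀ μ ∈ W, Shift (wordElt α * wordElt γ * (wordElt α)⁻¹) μ μ := by
    rcases hs with hs | hs
    · rwa [← hs]
    · rw [← hs]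
      exact fun μ hμ => (hfix μ hμ).symm
  obtain ⟨p, rfl⟩ := h1.exists_eq_inl (h2.exists_eq_inl_of_self hγ)
  obtain ⟨n, hn⟩ := exists_wordCylinder_of_mem_wordFilter
    (wordFilter_le_nhds p (hW.mem_nhds hμ))
  let w := α ++ (List.replicate (n + 1) γ).flatten
  have hw : Extends w ν (Sum.inl p) := extends_append.2 ⟨ν, h1, h2.flatten_replicate _⟩
  have hpos := List.length_pos_iff.2 hγ
  have hlen : n + 1 ≤ w.length := by
    have h3 : w.length = α.length + (n + 1) * γ.length := by simp [w]
    nlinarith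
  obtain ⟨A, hA, hAW⟩ := hn w ν (by omega) hw
  -- Intersecting with `C ∈ I_w` ensures that `w` can be placed in front of every `κ` under
  -- consideration.
  obtain ⟨C, hC, hCw⟩ := hw.nonempty (by rintro h; rw [h] at hlen; simp at hlen)
  have hAC := vset_inf hA hC
  refine ⟨γ, A ⊓ C, hγ, fun hb => bot_notMem_vset _ (hb ▸ hAC), fun κ hκ => ?_⟩
  have h4 : Extends w κ (prependWord w κ) :=
    extends_prependWord ⟨_, hκ, isLowerSet_wordIdeal w inf_le_right hCw⟩
  have h5 := hfix' _ (hAW ⟨κ, h4, vset_upper hκ inf_le_left⟩)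
  rw [← Shift.conj h4]
  rw [show wordElt w * wordElt γ * (wordElt w)⁻¹ =
    wordElt α * wordElt γ * (wordElt α)⁻¹ by
      simp only [w, wordElt_append, wordElt_flatten_replicate]
      group]
  exact h5

/-- For an ultrafilter `χ` containing `A`, a boundary path with range `χ` is unchanged by `γ`, so
`χ` contains `C` exactly if it contains `θ_γ(C)`. Elements below `A` are then compared through
ultrafilters. -/
theorem isCycle_of_forall_extends_self {γ : List L} {A : B} (hγ : γ ≠ []) (hA : A ≠ ⊥)
    (h : ∀ ν : S.BoundaryPath, A ∈ vset ν.r → Extends γ ν ν) : S.IsCycle γ A := by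
  -- This guarantees that every ultrafilter containing `θ_γ(C)` contains `A`. A path `ν` violating
  -- it could be prolonged to `γ ν`, whose range contains `A`; then `γ ν` equals its own remainder
  -- `ν`, so `A ∈ r(ν)`.
  have h1 : S.θw γ A ≤ A := by
    rw [← sdiff_eq_bot_iff]
    by_contra hne
    obtain ⟨χ, hχ⟩ := exists_vertex_mem hne
    obtain ⟨ν, hν⟩ := exists_boundaryPath_r_eq (S := S) χ
    have hν' : S.θw γ A \ A ∈ vset ν.r := by rw [hν]; exact hχ
    have h2 : S.θw γ A ∈ vset ν.r := vset_upper hν' sdiff_le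
    have h3 := extends_prependWord (S := S) ⟨_, h2, θw_mem_wordIdeal γ A⟩
    have h4 : A ∈ vset (prependWord γ ν).r := by rw [h3.vset_r]; exact h2
    have h5 := h _ h4
    rw [← h5.2, h3.2] at h4
    have h6 := vset_inf h4 hν'
    rw [inf_sdiff_self_right] at h6
    exact bot_notMem_vset _ h6
  have h2 : ∀ χ : Vertex B, A ∈ χ.1 → ∀ C, C ∈ χ.1 ↔ S.θw γ C ∈ χ.1 := by
    intro χ hχ C
    obtain ⟨ν, hν⟩ := exists_boundaryPath_r_eq (S := S) χ
    have h3 := (h ν (by rw [hν]; exact hχ)).vset_r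
    rw [hν, vset_coe] at h3
    exact Set.ext_iff.1 h3 C
  refine ⟨hγ, hA, fun C hC => le_antisymm ?_ ?_⟩ <;> rw [← sdiff_eq_bot_iff] <;> by_contra hne <;>
    obtain ⟨χ, hχ⟩ := exists_vertex_mem hne
  · have h3 : S.θw γ C ∈ χ.1 := χ.2.1.2.2.2.1 _ hχ _ (Set.mem_univ _) sdiff_le
    have h4 : A ∈ χ.1 :=
      χ.2.1.2.2.2.1 _ h3 _ (Set.mem_univ _) ((θw_mono γ hC).trans h1)
    exact χ.2.notMem_of_disjoint isLowerSet_univ hχ inf_sdiff_self_right ((h2 χ h4 C).2 h3)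
  · have h3 : C ∈ χ.1 := χ.2.1.2.2.2.1 _ hχ _ (Set.mem_univ _) sdiff_le
    have h4 : A ∈ χ.1 := χ.2.1.2.2.2.1 _ h3 _ (Set.mem_univ _) hC
    exact χ.2.notMem_of_disjoint isLowerSet_univ hχ inf_sdiff_self_right ((h2 χ h4 C).1 h3)

/-- Placing the first `t` letters of `γ` before `ν` gives a path whose range contains `A`, hence a
periodic path, and this prescribes the label of the first edge of `ν`. Every edge continues to a
boundary path, so no other label can occur in `Δ_C`. -/
theorem hasNoExits_of_forall_extends_self {γ : List L} {A : B} (hγ : γ ≠ [])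
    (h : ∀ ν : S.BoundaryPath, A ∈ vset ν.r → Extends γ ν ν) : S.HasNoExits γ A := by
  intro t ht htn
  have hpos := List.length_pos_iff.2 hγ
  obtain ⟨a, ha⟩ : ∃ a, γ[t % γ.length]? = some a :=
    ⟨_, List.getElem?_eq_getElem (Nat.mod_lt _ hpos)⟩
  have h1 : ∀ ν : S.BoundaryPath, S.θw (γ.take t) A ∈ vset ν.r →
      ∃ e, ν.edge 0 = some e ∧ e.label = a := by
    intro ν hν
    have h2 := extends_prependWord (S := S) ⟨_, hν, θw_mem_wordIdeal (γ.take t) A⟩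
    have h3 := h _ (by rw [h2.vset_r]; exact hν)
    have hlen : (γ.take t).length = t := by simpa using htn
    have h4 := h2.edge_add 0
    rw [hlen, add_zero] at h4
    rw [← h4]
    rcases htn.lt_or_eq with hlt | rfl
    · obtain ⟨e, he, hl⟩ := h3.1 t hlt
      rw [Nat.mod_eq_of_lt hlt, List.getElem?_eq_getElem hlt, Option.some.injEq] at ha
      exact ⟨e, he, hl.trans ha⟩
    -- For `t = |γ|` the next edge is the one with index `|γ|`, which by periodicity equals the edge
    -- with index `0`.
    · obtain ⟨e, he, hl⟩ := h3.1 0 hpos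
      rw [Nat.mod_self, List.getElem?_eq_getElem hpos, Option.some.injEq] at ha
      have h5 := h3.edge_add 0
      rw [add_zero] at h5
      exact ⟨e, h5.trans he, hl.trans ha⟩
  have h2 : ∀ C : B, C ≠ ⊥ → C ≤ S.θw (γ.take t) A → S.Δ C = {a} := by
    intro C hC hle
    refine Set.eq_singleton_iff_unique_mem.2 ⟨?_, fun b hb => ?_⟩
    · obtain ⟨χ, hχ⟩ := exists_vertex_mem hC
      obtain ⟨ν, hν⟩ := exists_boundaryPath_r_eq (S := S) χ
      have hCν : C ∈ vset ν.r := by rw [hν]; exact hχ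
      obtain ⟨e, he, rfl⟩ := h1 ν (vset_upper hCν hle)
      rw [r_eq_of_edge he] at hCν
      exact Edge.label_mem_Δ hCν
    · obtain ⟨e, rfl, he⟩ := exists_edge_of_mem_Δ hb
      obtain ⟨ν, hν⟩ := exists_boundaryPath_r_eq (S := S) e.d
      obtain ⟨e', he', hl⟩ := h1 (cons e ν hν.symm) (by rw [r_cons]; exact vset_upper he hle)
      rw [edge_cons_zero, Option.some.injEq] at he'
      rw [he', hl]
  refine fun C hC hle => ⟨fun D hD hDC => ?_, a, ha, h2 C hC hle⟩
  rw [h2 D hD (hDC.trans hle)]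
  exact ⟨Set.singleton_nonempty a, Set.finite_singleton a⟩

theorem topologicallyFree_of_conditionL (hL : S.ConditionL) : S.TopologicallyFree := by
  intro t ht
  by_contra hne
  obtain ⟨γ, A, hγ, hA, h⟩ := exists_forall_extends_self ht isOpen_interior
    (Set.nonempty_iff_ne_empty.2 hne)
    fun μ hμ => mem_fixedPoints_iff.1 (interior_subset hμ)
  exact hL ⟨γ, A, isCycle_of_forall_extends_self hγ hA h, hasNoExits_of_forall_extends_self hγ h⟩

/-! ### Topological freeness implies Condition (L) -/

/-- A boundary path of length `0` is a singular vertex and so contains no regular element. -/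
theorem exists_edge_of_isRegular {ρ : S.BoundaryPath} {C : B} {a : L} (hC : C ∈ vset ρ.r)
    (hreg : S.IsRegular C) (hΔ : S.Δ C = {a}) : ∃ e, ρ.edge 0 = some e ∧ e.label = a := by
  obtain ⟨e, he⟩ : ∃ e, ρ.edge 0 = some e := by
    rcases ρ with p | ⟨χ | ⟨n, p⟩, hp⟩
    · exact ⟨_, rfl⟩
    · exact absurd (exists_regular_mem_iff.2 ⟨C, hC, hreg⟩) hp
    · exact ⟨p.1 0, by simp [edge]⟩
  refine ⟨e, he, ?_⟩
  rw [r_eq_of_edge he] at hC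
  have := Edge.label_mem_Δ hC
  rwa [hΔ] at this

theorem startsWith_of_hasNoExits {α : List L} {A : B} (hc : S.IsCycle α A)
    (hx : S.HasNoExits α A) {μ : S.BoundaryPath} (hμ : A ∈ vset μ.r) :
    StartsWith α μ := by
  intro i
  induction i using Nat.strong_induction_on with
  | _ i ih =>
    intro hi
    have hlen : (α.take i).length = i := by simpa using hi.le
    have h1 : Extends (α.take i) (tail^[i] μ) μ := by
      refine ⟨fun j hj => ?_, by rw [hlen]⟩
      obtain ⟨e, he, hl⟩ := ih j (by omega) (by omega)
      exact ⟨e, he, by rw [hl, List.getElem_take]⟩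
    have h2 : S.θw (α.take i) A ∈ vset (tail^[i] μ).r := by
      rw [h1.vset_r] at hμ
      exact hμ
    have hne : S.θw (α.take i) A ≠ ⊥ := fun hb => bot_notMem_vset _ (hb ▸ h2)
    obtain ⟨hreg, a, ha, hΔ⟩ : S.IsRegular (S.θw (α.take i) A) ∧
        ∃ a, α[i]? = some a ∧ S.Δ (S.θw (α.take i) A) = {a} := by
      -- The no-exit condition starts at `t = 1`. Index `0` is covered by `t = |α|`, because `θ_α(A)
      -- = A`.
      rcases Nat.eq_zero_or_pos i with rfl | hpos
      · have h3 := hx α.length hi le_rfl A hne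
        rw [List.take_length, hc.2.2 A le_rfl, Nat.mod_self] at h3
        exact h3 le_rfl
      · have h3 := hx i hpos hi.le _ hne le_rfl
        rwa [Nat.mod_eq_of_lt hi] at h3
    obtain ⟨e, he, hl⟩ := exists_edge_of_isRegular h2 hreg hΔ
    rw [edge_iterate_tail, add_zero] at he
    rw [List.getElem?_eq_getElem hi, Option.some.injEq] at ha
    exact ⟨e, he, hl.trans ha.symm⟩

/-- As `θ_α` fixes everything below `A`, the ranges before and after removal of `α` have the same
members below `A`, and these determine an ultrafilter containing `A`. -/
theorem exists_extends_of_hasNoExits {α : List L} {A : B} (hc : S.IsCycle α A)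
    (hx : S.HasNoExits α A) {μ : S.BoundaryPath} (hμ : A ∈ vset μ.r) :
    ∃ ν, Extends α ν μ ∧ vset ν.r = vset μ.r := by
  have h1 : Extends α (tail^[α.length] μ) μ := ⟨startsWith_of_hasNoExits hc hx hμ, rfl⟩
  refine ⟨_, h1, ?_⟩
  have h2 := h1.vset_r
  have h3 : ∀ C ≤ A, C ∈ vset μ.r ↔ C ∈ vset (tail^[α.length] μ).r := by
    intro C hC
    rw [h2, Set.mem_ofPred_eq, hc.2.2 C hC]
  have hA := (h3 A le_rfl).1 hμ
  ext C
  constructor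
  · intro hC
    exact vset_upper ((h3 (C ⊓ A) inf_le_right).2 (vset_inf hC hA)) inf_le_left
  · intro hC
    exact vset_upper ((h3 (C ⊓ A) inf_le_right).1 (vset_inf hC hμ)) inf_le_left

theorem exists_extends_flatten_replicate {α : List L} {A : B} (hc : S.IsCycle α A)
    (hx : S.HasNoExits α A) (k : ℕ) {μ : S.BoundaryPath} (hμ : A ∈ vset μ.r) :
    ∃ ν, Extends (List.replicate k α).flatten ν μ ∧ vset ν.r = vset μ.r := by
  induction k generalizing μ with
  | zero => exact ⟨μ, extends_nil.2 rfl, rfl⟩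
  | succ k ih =>
    obtain ⟨κ, h1, h2⟩ := exists_extends_of_hasNoExits hc hx hμ
    obtain ⟨ν, h3, h4⟩ := ih (h2 ▸ hμ : A ∈ vset κ.r)
    rw [List.replicate_succ, List.flatten_cons]
    exact ⟨ν, extends_append.2 ⟨κ, h1, h3⟩, h4.trans h2⟩

/-- Write `μ = α ν`. Both `μ` and `ν` begin with every power of `α`, and the ranges at the ends of
these prefixes coincide, so `Extends.edge_eq` identifies all edges. -/
theorem extends_self_of_hasNoExits {α : List L} {A : B} (hc : S.IsCycle α A)
    (hx : S.HasNoExits α A) {μ : S.BoundaryPath} (hμ : A ∈ vset μ.r) :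
    Extends α μ μ := by
  obtain ⟨ν, h1, h2⟩ := exists_extends_of_hasNoExits hc hx hμ
  suffices h : μ = ν by rwa [← h] at h1
  refine eq_of_edge_eq fun i => ?_
  obtain ⟨κ, h3, h4⟩ := exists_extends_flatten_replicate hc hx (i + 1) hμ
  obtain ⟨κ', h5, h6⟩ := exists_extends_flatten_replicate hc hx (i + 1) (h2 ▸ hμ : A ∈ vset ν.r)
  have hi : i < (List.replicate (i + 1) α).flatten.length := by
    have hpos := List.length_pos_iff.2 hc.1
    have : (List.replicate (i + 1) α).flatten.length = (i + 1) * α.length := by simp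
    nlinarith
  obtain ⟨e, he, -⟩ := h3.1 i hi
  exact ⟨e, he, (h3.edge_eq h5 (h4.trans (h2.symm.trans h6.symm)) hi).symm.trans he⟩

theorem conditionL_of_topologicallyFree (hf : S.TopologicallyFree) : S.ConditionL := by
  rintro ⟨α, A, hc, hx⟩
  obtain ⟨χ, hχ⟩ := exists_vertex_mem hc.2.1
  obtain ⟨μ, hμ⟩ := exists_boundaryPath_r_eq (S := S) χ
  have hmem : μ ∈ (wordCylinder [] A : Set S.BoundaryPath) := by
    rw [mem_wordCylinder_nil, hμ]
    exact hχ
  have hsub : (wordCylinder [] A : Set S.BoundaryPath) ⊆ S.fixedPoints (wordElt α) := by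
    intro κ hκ
    rw [mem_wordCylinder_nil] at hκ
    exact mem_fixedPoints_iff.2 (shift_wordElt_iff.2 (extends_self_of_hasNoExits hc hx hκ))
  have h1 := interior_maximal hsub (isOpen_wordCylinder [] A) hmem
  rw [hf _ (wordElt_ne_one hc.1)] at h1
  exact h1

/-! ### The transformation groupoid -/

/-- Membership depends only on the labels `α` and on one element of `I_β` in the range of what
follows, hence it holds on a word cylinder. -/
theorem isOpen_U (t : FreeGroup L) : IsOpen (S.U t) := by
  by_cases ht : t = 1
  · have : S.U t = Set.univ := Set.eq_univ_of_forall fun μ => Or.inl ht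
    rw [this]
    exact isOpen_univ
  rw [isOpen_iff_forall_mem_open]
  intro μ hμ
  obtain ⟨α, β, ν, rfl, h1, h2⟩ := shift_iff.2 ⟨hμ, rfl⟩
  have hne : ∃ A ∈ vset ν.r, A ∈ S.wordIdeal β := by
    -- For empty `β` any member of `r(ν)` serves; one exists because `t ≠ 1` makes `α` nonempty.
    by_cases hβ : β = []
    · subst hβ
      have hα : α ≠ [] := by
        rintro rfl
        exact ht (by simp)
      obtain ⟨A, hA, -⟩ := h1.nonempty hα
      exact ⟨A, hA, Set.mem_univ _⟩
    · exact h2.nonempty hβ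
  obtain ⟨A, hA, hAβ⟩ := hne
  refine ⟨wordCylinder α A, ?_, isOpen_wordCylinder α A, ν, h1, hA⟩
  rintro κ ⟨ν', h3, hA'⟩
  exact (shift_iff.1 ⟨α, β, ν', rfl, h3, extends_prependWord ⟨A, hA', hAβ⟩⟩).1

theorem isOpen_arrows (t : FreeGroup L) {W : Set S.BoundaryPath} (hW : IsOpen W) :
    IsOpen {g : S.Arrow | g.1.1 = t ∧ g.1.2 ∈ W} := by
  let : TopologicalSpace (FreeGroup L) := ⊥
  have : DiscreteTopology (FreeGroup L) := ⟨rfl⟩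
  exact isOpen_induced_iff.2 ⟨{t} ×ˢ W, (isOpen_discrete {t}).prod hW, rfl⟩

theorem isOpen_slice (t : FreeGroup L) {O : Set S.Arrow} (hO : IsOpen O) :
    IsOpen {μ : S.BoundaryPath | ∃ h : μ ∈ S.U t, (⟨(t, μ), h⟩ : S.Arrow) ∈ O} := by
  let : TopologicalSpace (FreeGroup L) := ⊥
  obtain ⟨O', hO', rfl⟩ := isOpen_induced_iff.1 hO
  have : {μ : S.BoundaryPath | ∃ h : μ ∈ S.U t,
      (⟨(t, μ), h⟩ : S.Arrow) ∈ (Subtype.val ⁻¹' O' : Set S.Arrow)} =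
      S.U t ∩ (fun μ => (t, μ)) ⁻¹' O' := by
    ext μ
    constructor
    · rintro ⟨h, hμ⟩
      exact ⟨h, hμ⟩
    · rintro ⟨h, hμ⟩
      exact ⟨h, hμ⟩
  rw [this]
  exact (isOpen_U t).inter (hO'.preimage (Continuous.prodMk_right t))

theorem Arrow.mem_iso_iff {g : S.Arrow} :
    g ∈ S.transformationGroupoid.iso ↔ Shift g.1.1 g.1.2 g.1.2 := by
  constructor
  · intro h
    have h1 := g.shift
    rwa [show g.source = g.1.2 from h] at h1
  · intro h
    exact Arrow.source_eq h

/-- The slice over `t` of the interior of the isotropy is an open subset of the fixed points of `t`,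
so it is empty for `t ≠ 1`; the slice over `1` consists of units. -/
theorem effective_of_topologicallyFree (hf : S.TopologicallyFree) :
    S.transformationGroupoid.Effective := by
  refine subset_antisymm ?_ (interior_maximal ?_ ?_)
  · intro g hg
    by_cases ht : g.1.1 = 1
    · exact ⟨g.1.2, Subtype.ext (Prod.ext ht.symm rfl)⟩
    · exfalso
      have h1 : g.1.2 ∈ interior (S.fixedPoints g.1.1) := by
        refine interior_maximal ?_ (isOpen_slice g.1.1 isOpen_interior) ⟨g.2, hg⟩
        rintro μ ⟨h, hμ⟩
        exact mem_fixedPoints_iff.2 (Arrow.mem_iso_iff.1 (interior_subset hμ))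
      rw [hf _ ht] at h1
      exact h1
  · rintro _ ⟨μ, rfl⟩
    exact (S.transformationGroupoid.s_one μ).trans (S.transformationGroupoid.r_one μ).symm
  · have : Set.range S.transformationGroupoid.one =
        {g : S.Arrow | g.1.1 = 1 ∧ g.1.2 ∈ Set.univ} := by
      ext g
      constructor
      · rintro ⟨μ, rfl⟩
        exact ⟨rfl, trivial⟩
      · rintro ⟨h, -⟩
        exact ⟨g.1.2, Subtype.ext (Prod.ext h.symm rfl)⟩
    rw [this]
    exact isOpen_arrows 1 isOpen_univ

theorem topologicallyFree_of_effective (he : S.transformationGroupoid.Effective) :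
    S.TopologicallyFree := by
  intro t ht
  refine Set.eq_empty_of_forall_notMem fun μ hμ => ht ?_
  have hs := mem_fixedPoints_iff.1 (interior_subset hμ)
  have h1 : (⟨(t, μ), (shift_iff.1 hs).1⟩ : S.Arrow) ∈ interior S.transformationGroupoid.iso := by
    refine interior_maximal ?_ (isOpen_arrows t isOpen_interior) ⟨rfl, hμ⟩
    rintro ⟨⟨s, κ⟩, hκ⟩ ⟨h2, h3⟩
    obtain rfl : s = t := h2
    exact Arrow.mem_iso_iff.2 (mem_fixedPoints_iff.1 (interior_subset h3))
  rw [he] at h1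
  obtain ⟨κ, hκ⟩ := h1
  exact (congrArg (fun g : S.Arrow => g.1.1) hκ).symm

theorem isotropyAt_eq_iff {μ : S.BoundaryPath} :
    S.transformationGroupoid.isotropyAt μ = {S.transformationGroupoid.one μ} ↔
      ∀ t : FreeGroup L, t ≠ 1 → ¬ Shift t μ μ := by
  constructor
  · intro h t ht hs
    have h1 : (⟨(t, μ), (shift_iff.1 hs).1⟩ : S.Arrow) ∈
        S.transformationGroupoid.isotropyAt μ := ⟨rfl, Arrow.source_eq hs⟩
    rw [h] at h1
    exact ht (congrArg (fun g : S.Arrow => g.1.1) h1)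
  · intro h
    refine Set.eq_singleton_iff_unique_mem.2
      ⟨⟨S.transformationGroupoid.r_one μ, S.transformationGroupoid.s_one μ⟩, ?_⟩
    rintro ⟨⟨t, κ⟩, hg⟩ ⟨h1, h2⟩
    obtain rfl : κ = μ := h1
    have h3 : Shift t κ κ := Arrow.mem_iso_iff.1 (h2 : Arrow.source _ = κ)
    obtain rfl : t = 1 := by
      by_contra ht
      exact h t ht h3
    rfl

theorem topologicallyFree_of_topologicallyPrincipal
    (hp : S.transformationGroupoid.TopologicallyPrincipal) : S.TopologicallyFree := by
  intro t ht
  by_contra hne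
  obtain ⟨μ, hμ, hμ'⟩ := hp.inter_open_nonempty _ isOpen_interior
    (Set.nonempty_iff_ne_empty.2 hne)
  exact isotropyAt_eq_iff.1 hμ' t ht (mem_fixedPoints_iff.1 (interior_subset hμ))

/-! ### Topological freeness implies topological principality -/

theorem mem_vset_r_iff_of_edge {ρ : S.BoundaryPath} {e : S.Edge} (h : ρ.edge 0 = some e) {D : B} :
    D ∈ vset ρ.r ↔ S.θ e.label D ∈ vset ρ.tail.r := by
  obtain ⟨hr, hρ⟩ := exists_eq_cons h
  have h1 := vset_r_cons e ρ.tail hr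
  rw [← hρ] at h1
  rw [h1, Set.mem_ofPred_eq]

/-- A decreasing sequence of nonempty word cylinders with words of increasing length
has a common point. -/
theorem exists_forall_mem_wordCylinder {w : ℕ → List L} {A : ℕ → B}
    (hpre : ∀ k, w k <+: w (k + 1)) (hlen : ∀ k, k < (w k).length)
    (hsub : ∀ k, (wordCylinder (w (k + 1)) (A (k + 1)) : Set S.BoundaryPath) ⊆
      wordCylinder (w k) (A k))
    (hA : A 0 ∈ S.wordIdeal (w 0))
    (hne : ∀ k, (wordCylinder (w k) (A k) : Set S.BoundaryPath).Nonempty) :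
    ∃ μ : S.BoundaryPath, ∀ k, μ ∈ wordCylinder (w k) (A k) := by
  choose ν hν using hne
  have hanti : Antitone fun k => (wordCylinder (w k) (A k) : Set S.BoundaryPath) :=
    antitone_nat_of_succ_le hsub
  have hprefix : ∀ {j k}, j ≤ k → w j <+: w k := fun {j k} hjk =>
    Nat.le_induction (List.prefix_refl _) (fun k _ ih => ih.trans (hpre k)) k hjk
  let a : ℕ → L := fun i => (w i)[i]'(hlen i)
  have hw : ∀ k i (h : i < (w k).length), (w k)[i] = a i := by
    intro k i h
    rcases le_total i k with hik | hik
    · exact ((hprefix hik).getElem (hlen i)).symm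
    · exact (hprefix hik).getElem h
  have hedge : ∀ {k i}, i ≤ k → ∃ e, (ν k).edge i = some e ∧ e.label = a i := by
    intro k i hik
    obtain ⟨_, ⟨h1, -⟩, -⟩ := hν k
    have hi := hik.trans_lt (hlen k)
    obtain ⟨e, he, hl⟩ := h1 i hi
    exact ⟨e, he, hl.trans (hw k i hi)⟩
  -- One element `C` works for all `k`. Its images `c i` along the limit word keep the limit
  -- ultrafilters nonempty and make them meet the ideals of the letters.
  obtain ⟨C, hC, hCν⟩ : ∃ C ∈ S.ideal (a 0), ∀ k, C ∈ vset (tail (ν k)).r := by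
    rcases hw0 : w 0 with _ | ⟨b, u⟩
    · have := hlen 0
      simp [hw0] at this
    · have hb : b = a 0 := by
        have := hw 0 0 (hlen 0)
        simpa [hw0] using this
      rw [hw0] at hA
      obtain ⟨C, hC, hle⟩ := hA
      refine ⟨C, hb ▸ hC, fun k => ?_⟩
      obtain ⟨κ, h1, h2⟩ := hanti (Nat.zero_le k) (hν k)
      rw [hw0] at h1
      obtain ⟨e, κ', hr, h3, -, h4⟩ := extends_cons.1 h1
      rw [h3, tail_cons, h4.vset_r]
      exact vset_upper h2 hle
  let c : ℕ → B := fun i => Nat.rec C (fun i D => S.θ (a (i + 1)) D) i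
  have hcI : ∀ i, c i ∈ S.ideal (a i) := by
    rintro (_ | i)
    · exact hC
    · exact S.θ_mem _ _
  have hstep : ∀ {k i}, i + 1 ≤ k → ∀ D, D ∈ vset (tail^[i + 1] (ν k)).r ↔
      S.θ (a (i + 1)) D ∈ vset (tail^[i + 2] (ν k)).r := by
    intro k i hik D
    obtain ⟨e, he, hl⟩ := hedge hik
    rw [mem_vset_r_iff_of_edge (e := e) (by rw [edge_iterate_tail, add_zero, he]), hl,
      ← Function.iterate_succ_apply' tail]
  have hcν : ∀ {k i}, i ≤ k → c i ∈ vset (tail^[i + 1] (ν k)).r := by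
    intro k i
    induction i with
    | zero => exact fun _ => hCν k
    | succ i ih => exact fun hik => (hstep hik _).1 (ih (by omega))
  have hev : ∀ i, ∀ᶠ k in (Filter.hyperfilter ℕ : Filter ℕ), i ≤ k := fun i =>
    Nat.hyperfilter_le_atTop (Filter.eventually_ge_atTop i)
  -- For `i ≤ k`, the range after `i + 1` edges of `ν k` is the `d` of its edge with index `i`. The
  -- limits of these vertices are the `d` of the edges of the common point, and `hstep` passes to
  -- the limit to give composability.
  let χ : ℕ → Vertex B := fun i =>
    ⟨{D | ∀ᶠ k in (Filter.hyperfilter ℕ : Filter ℕ), D ∈ vset (tail^[i + 1] (ν k)).r},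
      isUltrafilterIn_limit isLowerSet_univ _
        ((hev i).mono fun k hk => isUltrafilterIn_vset (hcν hk))
        ((hev i).mono fun k hk => hcν hk)⟩
  have hχ : ∀ i, ((χ i).1 ∩ S.ideal (a i)).Nonempty := fun i =>
    ⟨c i, (hev i).mono fun k hk => hcν hk, hcI i⟩
  let p : S.InfPath := ⟨fun i => edgeTo (a i) (χ i) (hχ i), by
    intro i
    rw [edgeTo_d]
    refine vset_injective ?_
    rw [Edge.vset_r]
    ext D
    refine (Filter.eventually_congr ((hev (i + 1)).mono fun k hk => hstep hk D)).trans ?_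
    exact ⟨fun h => ⟨h, S.θ_mem _ _⟩, fun h => h.1⟩⟩
  refine ⟨Sum.inl p, fun k => ⟨_, ⟨fun i hi => ⟨p.1 i, rfl, (hw k i hi).symm⟩, rfl⟩, ?_⟩⟩
  obtain ⟨j, hj⟩ := Nat.exists_eq_succ_of_ne_zero (Nat.zero_le k |>.trans_lt (hlen k)).ne'
  have hj' : vset (tail^[j + 1] (Sum.inl p : S.BoundaryPath)).r = (χ j).1 := by
    refine (vset_r_tail_of_edge (k := j) (e := p.1 j) rfl).trans ?_
    rw [edgeTo_d]
  rw [hj]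
  refine hj'.symm ▸ (hev k).mono fun k' hk' => ?_
  obtain ⟨κ, ⟨-, rfl⟩, h2⟩ := hanti hk' (hν k')
  rwa [hj] at h2

/-- Otherwise all paths of `O` sharing the first `n + 1 + m` letters of `p₀` would be fixed by one
nontrivial group element, the conjugate of the last `n + 1` of these letters by the first `m`. -/
theorem exists_mem_iterate_tail_ne (hf : S.TopologicallyFree) {O : Set S.BoundaryPath}
    (hO : IsOpen O) {p₀ : S.InfPath} (hp₀ : Sum.inl p₀ ∈ O) (m n : ℕ) :
    ∃ μ ∈ O, tail^[n + 1 + m] μ ≠ tail^[m] μ := by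
  obtain ⟨w, ν, hw, hν⟩ := exists_extends_inl p₀ (n + 1 + m)
  have hm : (w.take m).length = m := by
    rw [List.length_take, hw]
    omega
  have hn : w.drop m ≠ [] := by
    rw [← List.length_pos_iff, List.length_drop, hw]
    omega
  obtain ⟨A, hA⟩ := vset_r_nonempty_of_extends_inl (by rintro rfl; simp at hn) hν
  by_contra! hcon
  have hsub : O ∩ wordCylinder w A ⊆
      S.fixedPoints (wordElt (w.take m) * wordElt (w.drop m) * (wordElt (w.take m))⁻¹) := by
    rintro μ ⟨hμO, κ, hκ, -⟩
    have h1 := hcon μ hμO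
    rw [mem_fixedPoints_iff]
    have h2 := hκ.2
    rw [hw, h1] at h2
    rw [← List.take_append_drop m w] at hκ
    obtain ⟨κ', h3, h4⟩ := extends_append.1 hκ
    have h5 := h3.2
    rw [hm, h2] at h5
    subst h5
    exact (Shift.conj h3).2 h4
  have h1 := interior_maximal hsub (hO.inter (isOpen_wordCylinder w A)) ⟨hp₀, ν, hν, hA⟩
  rw [hf _ fun h => wordElt_ne_one hn (conj_eq_one_iff.1 h)] at h1
  exact h1

/-- Two different tails of an infinite path differ in some edge, and disjoint neighbourhoods of the
two edges keep them different nearby. -/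
theorem eventually_iterate_tail_ne {p : S.InfPath} {m n : ℕ}
    (h : tail^[n] (Sum.inl p : S.BoundaryPath) ≠ tail^[m] (Sum.inl p)) :
    ∀ᶠ κ in wordFilter p, tail^[n] κ ≠ tail^[m] κ := by
  obtain ⟨i, hi⟩ : ∃ i, p.1 (n + i) ≠ p.1 (m + i) := by
    by_contra! hcon
    refine h (eq_of_edge_eq fun i => ⟨p.1 (n + i), edge_iterate_tail _ n i, ?_⟩)
    exact (edge_iterate_tail _ m i).trans (congrArg some (hcon i).symm)
  obtain ⟨O, O', hO, hO', hmO, hmO', hd⟩ := t2_separation hi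
  filter_upwards [eventually_edge_mem (hO.mem_nhds hmO), eventually_edge_mem (hO'.mem_nhds hmO')]
  rintro κ ⟨e, he, h1⟩ ⟨e', he', h2⟩ heq
  rw [← edge_iterate_tail, heq, edge_iterate_tail, h2, Option.some.injEq] at h1
  exact Set.disjoint_left.1 hd he (h1 ▸ he')

theorem topologicallyPrincipal_of_topologicallyFree (hf : S.TopologicallyFree) :
    S.transformationGroupoid.TopologicallyPrincipal := by
  refine dense_iff_inter_open.2 fun W hW hne => ?_
  suffices h : ∃ μ ∈ W, ∀ t : FreeGroup L, t ≠ 1 → ¬ Shift t μ μ by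
    obtain ⟨μ, hμ, h⟩ := h
    exact ⟨μ, hμ, isotropyAt_eq_iff.2 h⟩
  by_cases hinf : ∀ μ ∈ W, ∃ p, μ = Sum.inl p
  swap
  -- A path that is not infinite already has trivial isotropy, since fixed paths are infinite.
  · push Not at hinf
    obtain ⟨μ, hμ, h⟩ := hinf
    refine ⟨μ, hμ, fun t ht hs => ?_⟩
    obtain ⟨α, γ, ν, hγ, -, h1, h2⟩ := hs.exists_periodic ht
    obtain ⟨p, hp⟩ := h1.exists_eq_inl (h2.exists_eq_inl_of_self hγ)
    exact h p hp
  let X := {x : List L × B // (wordCylinder x.1 x.2 : Set S.BoundaryPath).Nonempty ∧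
    (wordCylinder x.1 x.2 : Set S.BoundaryPath) ⊆ W}
  -- The density step: inside any cylinder of `X` there is a smaller one, with a strictly longer
  -- word, on all of which the condition for `(m, n)` holds.
  have hstep : ∀ (m n : ℕ) (x : X), ∃ y : X, x.1.1 <+: y.1.1 ∧ x.1.1.length < y.1.1.length ∧
      (wordCylinder y.1.1 y.1.2 : Set S.BoundaryPath) ⊆ wordCylinder x.1.1 x.1.2 ∧
      ∀ κ ∈ (wordCylinder y.1.1 y.1.2 : Set S.BoundaryPath), tail^[n + 1 + m] κ ≠ tail^[m] κ := by
    rintro m n ⟨⟨w, A⟩, ⟨μ₀, hμ₀⟩, hxW⟩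
    obtain ⟨p₀, rfl⟩ := hinf μ₀ (hxW hμ₀)
    obtain ⟨μ, hμ, hμne⟩ := exists_mem_iterate_tail_ne hf (isOpen_wordCylinder w A) hμ₀ m n
    obtain ⟨p, rfl⟩ := hinf μ (hxW hμ)
    obtain ⟨N, hN⟩ := exists_wordCylinder_of_mem_wordFilter
      (Filter.inter_mem (wordCylinder_mem_wordFilter hμ) (eventually_iterate_tail_ne hμne))
    obtain ⟨w', ν', hw', hν'⟩ := exists_extends_inl p (N + (w.length + 1))
    obtain ⟨A', hA', hsub⟩ := hN w' ν' (by omega) hν'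
    obtain ⟨ν, hν, -⟩ := hμ
    obtain ⟨γ, rfl, -⟩ := hν.split hν' (by omega)
    refine ⟨⟨(_, A'), ⟨_, ν', hν', hA'⟩, fun κ hκ => hxW (hsub hκ).1⟩, List.prefix_append _ _, ?_,
      fun κ hκ => (hsub hκ).1, fun κ hκ => (hsub hκ).2⟩
    change w.length < (w ++ γ).length
    omega
  choose next hnext using hstep
  -- The starting cylinder has its element in `I_w`, as required for the existence of a common
  -- point.
  obtain ⟨x₀, hx₀, hx₀'⟩ : ∃ x : X, 0 < x.1.1.length ∧ x.1.2 ∈ S.wordIdeal x.1.1 := by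
    obtain ⟨μ, hμ⟩ := hne
    obtain ⟨p, rfl⟩ := hinf μ hμ
    obtain ⟨N, hN⟩ := exists_wordCylinder_of_mem_wordFilter
      (wordFilter_le_nhds p (hW.mem_nhds hμ))
    obtain ⟨w, ν, hw, hν⟩ := exists_extends_inl p (N + 1)
    obtain ⟨A, hA, hsub⟩ := hN w ν (by omega) hν
    obtain ⟨C, hC, hCw⟩ := hν.nonempty (by rintro rfl; simp at hw)
    refine ⟨⟨(w, A ⊓ C), ⟨_, ν, hν, vset_inf hA hC⟩, (wordCylinder_mono inf_le_left).trans hsub⟩,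
      ?_, isLowerSet_wordIdeal w inf_le_right hCw⟩
    change 0 < w.length
    omega
  -- The pairing function runs through all `(m, n)`; the condition for `(m, n)` is imposed at stage
  -- `Nat.pair m n + 1`.
  let x : ℕ → X := fun k => Nat.rec x₀ (fun k y => next k.unpair.1 k.unpair.2 y) k
  have hx : ∀ k, x (k + 1) = next k.unpair.1 k.unpair.2 (x k) := fun k => rfl
  have hlen : ∀ k, k < (x k).1.1.length := by
    intro k
    induction k with
    | zero => exact hx₀
    | succ k ih =>
      rw [hx]
      exact (Nat.succ_le_of_lt ih).trans_lt (hnext _ _ (x k)).2.1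
  obtain ⟨μ, hμ⟩ := exists_forall_mem_wordCylinder (fun k => hx k ▸ (hnext _ _ (x k)).1) hlen
    (fun k => hx k ▸ (hnext _ _ (x k)).2.2.1) hx₀' fun k => (x k).2.1
  refine ⟨μ, (x 0).2.2 (hμ 0), fun t ht => not_shift_of_forall_iterate_tail_ne ?_ ht⟩
  intro m n
  have h1 := (hnext _ _ (x (Nat.pair m n))).2.2.2 μ (hx _ ▸ hμ (Nat.pair m n + 1))
  simpa using h1

end GenBooleanDynamicalSystem

end BooleanDynamics

theorem mainTheorem5 {B : Type*} {L : Type*} [GeneralizedBooleanAlgebra B]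
    (S : BooleanDynamics.GenBooleanDynamicalSystem B L) :
    (S.toBooleanDynamicalSystem.ConditionL ↔ S.TopologicallyFree) ∧
    (S.TopologicallyFree ↔ S.transformationGroupoid.TopologicallyPrincipal) ∧
    (S.transformationGroupoid.TopologicallyPrincipal → S.transformationGroupoid.Effective) ∧
    (Countable B → Countable L →
      S.transformationGroupoid.Effective → S.transformationGroupoid.TopologicallyPrincipal) := by
  open BooleanDynamics.GenBooleanDynamicalSystem in
  exact ⟨⟨topologicallyFree_of_conditionL, conditionL_of_topologicallyFree⟩,
    ⟨topologicallyPrincipal_of_topologicallyFree, topologicallyFree_of_topologicallyPrincipal⟩,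
    fun h => effective_of_topologicallyFree (topologicallyFree_of_topologicallyPrincipal h),
    fun _ _ h => topologicallyPrincipal_of_topologicallyFree (topologicallyFree_of_effective h)⟩
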